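/- Let $G$ be a finite abelian group acting by $\mathbb{C}$-algebra automorphisms on $A=M_n(\mathbb{C})$, $n\ge 1$, and let $A'=G\ltimes A$ be the crossed product, i.e. the algebra of formal sums $\sum_{g\in G}a_g\,g$ with $(a\,g)(b\,h)=a\,g(b)\,gh$. Let $K_0(A')$ be the Grothendieck group of finitely generated projective left $A'$-modules and let $K_1(A')=\varinjlim_m\pi_0(GL_m(A'))$ be the topological $K_1$-group of the finite-dimensional (Banach) algebra $A'$. Let $R(G)$ be the complex representation ring of $G$; it acts on $K_0(A')$ by $[V]\cdot[E]=[V\otimes_{\mathbb{C}}E]$, where $a\in A$ acts on $V\otimes_{\mathbb{C}} E$ by $1\otimes a$ and $g\in G$ acts diagonally. Let $$\widetilde G=\{(g,u)\in G\times SL_n(\mathbb{C}) : g(a)=u\,a\,u^{-1}\text{ for all }a\in A\}$$ be the associated central extension of $G$ by the group $\mu_n$ of $n$-th roots of unity (if $G$ acts by $*$-automorphisms, i.e. through $PU(n)$, then $\widetilde G$ is the pull-back of $SU(n)\to PU(n)$ along $G\to PU(n)$), and let $G'\subseteq G$ be the image of the center of $\widetilde G$. Then: 1. The complex topological $K$-theory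 $K_*(A')=K_0(A')\oplus K_1(A')$ is concentrated in degree $0$, i.e. $K_1(A')=0$, and $K_0(A')$ is a finitely generated free $\mathbb{Z}$-module. 2. The ring $R(G)\otimes\mathbb{Q}$ is isomorphic to the group algebra $\mathbb{Q}[G]$, and, as an $R(G)\otimes\mathbb{Q}$-module, $K_0(A')\otimes\mathbb{Q}$ is isomorphic to $R(G')\otimes\mathbb{Q}$, on which $R(G)\otimes\mathbb{Q}$ acts through restriction of representations from $G$ to $G'$. 3. In particular, the rank of $K_0(A')$ divides $|G|$. -/

import Mathlib

open scoped TensorProduct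

noncomputable section

namespace TwistedK

universe u v w

/-! ### Grothendieck groups of semirings and of modules over them -/

section Grothendieck

open Algebra (GrothendieckAddGroup)

theorem groth_hom_ext {M N : Type*} [AddCommMonoid M] [AddCommGroup N]
    {f g : GrothendieckAddGroup M →+ N}
    (h : ∀ m, f (GrothendieckAddGroup.of m) = g (GrothendieckAddGroup.of m)) : f = g :=
  GrothendieckAddGroup.lift.symm.injective (AddMonoidHom.ext h)

theorem groth_lift_of {M N : Type*} [AddCommMonoid M] [AddCommGroup N] (f : M →+ N) (m : M) :
    GrothendieckAddGroup.lift f (GrothendieckAddGroup.of m) = f m :=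
  DFunLike.congr_fun (GrothendieckAddGroup.lift.symm_apply_apply f) m

/-- The biadditive extension to Grothendieck groups of the action of a semiring `S` on an
`S`-semimodule `M`. -/
def grothAct (S M : Type*) [Semiring S] [AddCommMonoid M] [Module S M] :
    GrothendieckAddGroup S →+ GrothendieckAddGroup M →+ GrothendieckAddGroup M :=
  GrothendieckAddGroup.lift
    { toFun := fun s => GrothendieckAddGroup.lift
        ((GrothendieckAddGroup.of (M := M)).comp (DistribSMul.toAddMonoidHom M s))
      map_zero' := groth_hom_ext fun m => by
        rw [groth_lift_of]; simp
      map_add' := fun s t => groth_hom_ext fun m => by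
        rw [AddMonoidHom.add_apply]; simp only [groth_lift_of]; simp [add_smul] }

theorem grothAct_of_of {S M : Type*} [Semiring S] [AddCommMonoid M] [Module S M] (s : S) (m : M) :
    grothAct S M (GrothendieckAddGroup.of s) (GrothendieckAddGroup.of m) =
      GrothendieckAddGroup.of (s • m) := by
  rw [grothAct, groth_lift_of]
  exact groth_lift_of _ _

theorem groth_induction {M : Type*} [AddCommMonoid M] {p : GrothendieckAddGroup M → Prop}
    (h : ∀ m, p (GrothendieckAddGroup.of m)) (hsub : ∀ x y, p x → p y → p (x - y))
    (x : GrothendieckAddGroup M) : p x := by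
  induction x using AddLocalization.ind with
  | _ y =>
    have hy : AddLocalization.mk y.1 y.2 =
        GrothendieckAddGroup.of y.1 - GrothendieckAddGroup.of (y.2 : M) := by
      rw [eq_sub_iff_add_eq, GrothendieckAddGroup.of, AddSubmonoid.LocalizationMap.toAddMonoidHom_apply,
        AddSubmonoid.LocalizationMap.toAddMonoidHom_apply, AddLocalization.mk_eq_addMonoidOf_mk']
      exact AddSubmonoid.LocalizationMap.mk'_spec _ _ _
    rw [hy]
    exact hsub _ _ (h _) (h _)

theorem grothAct_one {S M : Type*} [Semiring S] [AddCommMonoid M] [Module S M]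
    (x : GrothendieckAddGroup M) : grothAct S M (GrothendieckAddGroup.of 1) x = x := by
  induction x using groth_induction with
  | h m => rw [grothAct_of_of, one_smul]
  | hsub x y hx hy => rw [map_sub, hx, hy]

theorem grothAct_assoc {S M : Type*} [Semiring S] [AddCommMonoid M] [Module S M]
    (a b : GrothendieckAddGroup S) (x : GrothendieckAddGroup M) :
    grothAct S M (grothAct S S a b) x = grothAct S M a (grothAct S M b x) := by
  induction a using groth_induction with
  | hsub a a' h h' => simp only [map_sub, AddMonoidHom.sub_apply, h, h']
  | h s =>
  induction b using groth_induction with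
  | hsub a a' h h' => simp only [map_sub, AddMonoidHom.sub_apply, h, h']
  | h t =>
  induction x using groth_induction with
  | hsub a a' h h' => simp only [map_sub, h, h']
  | h m => simp only [grothAct_of_of, smul_smul, smul_eq_mul]

theorem grothAct_comm {S : Type*} [CommSemiring S] (a b : GrothendieckAddGroup S) :
    grothAct S S a b = grothAct S S b a := by
  induction a using groth_induction with
  | hsub a a' h h' => simp only [map_sub, AddMonoidHom.sub_apply, h, h']
  | h s =>
  induction b using groth_induction with
  | hsub a a' h h' => simp only [map_sub, AddMonoidHom.sub_apply, h, h']
  | h t => simp only [grothAct_of_of, smul_eq_mul, mul_comm]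

/-- The Grothendieck ring of a commutative semiring. -/
instance grothCommRing (S : Type*) [CommSemiring S] : CommRing (GrothendieckAddGroup S) where
  __ := (inferInstance : AddCommGroup (GrothendieckAddGroup S))
  mul a b := grothAct S S a b
  one := GrothendieckAddGroup.of 1
  mul_assoc a b c := grothAct_assoc a b c
  one_mul a := grothAct_one a
  mul_one a := (grothAct_comm a _).trans (grothAct_one a)
  left_distrib a b c := map_add (grothAct S S a) b c
  right_distrib a b c := DFunLike.congr_fun (map_add (grothAct S S) a b) c
  zero_mul a := DFunLike.congr_fun (map_zero (grothAct S S)) a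
  mul_zero a := map_zero (grothAct S S a)
  mul_comm a b := grothAct_comm a b

/-- The Grothendieck group of a semimodule is a module over the Grothendieck ring. -/
abbrev grothModule (S M : Type*) [CommSemiring S] [AddCommMonoid M] [Module S M] :
    Module (GrothendieckAddGroup S) (GrothendieckAddGroup M) where
  smul a x := grothAct S M a x
  one_smul x := grothAct_one x
  mul_smul a b x := grothAct_assoc a b x
  smul_zero a := map_zero (grothAct S M a)
  smul_add a x y := map_add (grothAct S M a) x y
  add_smul a b x := DFunLike.congr_fun (map_add (grothAct S M) a b) x
  zero_smul x := DFunLike.congr_fun (map_zero (grothAct S M)) x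

/-- Functoriality of the Grothendieck ring. -/
def grothMap {S T : Type*} [CommSemiring S] [CommSemiring T] (f : S →+* T) :
    GrothendieckAddGroup S →+* GrothendieckAddGroup T where
  __ := GrothendieckAddGroup.lift ((GrothendieckAddGroup.of (M := T)).comp f.toAddMonoidHom)
  map_one' := by
    refine (groth_lift_of _ (1 : S)).trans ?_
    change GrothendieckAddGroup.of (f 1) = GrothendieckAddGroup.of 1
    rw [map_one]
  map_mul' a b := by
    let F : GrothendieckAddGroup S →+ GrothendieckAddGroup T :=
      GrothendieckAddGroup.lift ((GrothendieckAddGroup.of (M := T)).comp f.toAddMonoidHom)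
    have hF : ∀ s, F (GrothendieckAddGroup.of s) = GrothendieckAddGroup.of (f s) :=
      fun s => groth_lift_of _ s
    change F (grothAct S S a b) = grothAct T T (F a) (F b)
    induction a using groth_induction with
    | hsub a a' h h' => simp only [map_sub, AddMonoidHom.sub_apply, h, h']
    | h s =>
    induction b using groth_induction with
    | hsub a a' h h' => simp only [map_sub, h, h']
    | h t => rw [grothAct_of_of, hF, hF, hF, grothAct_of_of, smul_eq_mul, smul_eq_mul, map_mul]

end Grothendieck

/-! ### The representation ring -/

section RepRing

/-- A finite-dimensional complex representation of `G`. -/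
structure FinRep (G : Type u) [Group G] where
  carrier : Type
  [addCommGroup : AddCommGroup carrier]
  [module : Module ℂ carrier]
  [finite : Module.Finite ℂ carrier]
  ρ : Representation ℂ G carrier

attribute [instance] FinRep.addCommGroup FinRep.module FinRep.finite

variable (G : Type u) [Group G]

instance FinRep.setoid : Setoid (FinRep G) where
  r V W := Nonempty (V.ρ.Equiv W.ρ)
  iseqv := ⟨fun _ => ⟨.refl _⟩, fun ⟨e⟩ => ⟨e.symm⟩, fun ⟨e⟩ ⟨f⟩ => ⟨e.trans f⟩⟩

/-- Isomorphism classes of finite-dimensional complex representations of `G`. -/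
def RepClass : Type (max 1 u) := Quotient (FinRep.setoid G)

variable {G}

/-- Two representations related by an equivariant linear isomorphism have the same class. -/
theorem RepClass.sound {V W : FinRep G} (e : V.carrier ≃ₗ[ℂ] W.carrier)
    (h : ∀ g v, e (V.ρ g v) = W.ρ g (e v)) :
    (Quotient.mk (FinRep.setoid G) V : RepClass G) = Quotient.mk (FinRep.setoid G) W :=
  Quotient.sound ⟨.mk e fun g => LinearMap.ext fun v => h g v⟩

/-- Equivariance of an isomorphism out of a tensor product is checked on pure tensors. -/
theorem equivariant_of_tmul {V W U : Type*} [AddCommGroup V] [AddCommGroup W] [AddCommGroup U]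
    [Module ℂ V] [Module ℂ W] [Module ℂ U] (e : V ⊗[ℂ] W →ₗ[ℂ] U) (f : V ⊗[ℂ] W →ₗ[ℂ] V ⊗[ℂ] W)
    (g : U →ₗ[ℂ] U) (h : ∀ v w, e (f (v ⊗ₜ w)) = g (e (v ⊗ₜ w))) (x : V ⊗[ℂ] W) :
    e (f x) = g (e x) :=
  LinearMap.congr_fun (TensorProduct.ext' (g := e ∘ₗ f) (h := g ∘ₗ e) h) x

/-- Direct sum of representations. -/
def FinRep.sum (V W : FinRep G) : FinRep G := ⟨V.carrier × W.carrier, V.ρ.prod W.ρ⟩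

/-- Tensor product of representations, with the diagonal action. -/
def FinRep.tensor (V W : FinRep G) : FinRep G := ⟨V.carrier ⊗[ℂ] W.carrier, V.ρ.tprod W.ρ⟩

instance : Add (RepClass G) where
  add := Quotient.map₂ FinRep.sum fun _ _ ⟨e⟩ _ _ ⟨f⟩ =>
    ⟨.mk (e.toLinearEquiv.prodCongr f.toLinearEquiv) fun g => LinearMap.ext fun v =>
      Prod.ext (Representation.IntertwiningMap.isIntertwining _ _ e.toIntertwiningMap g v.1) (Representation.IntertwiningMap.isIntertwining _ _ f.toIntertwiningMap g v.2)⟩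

instance : Mul (RepClass G) where
  mul := Quotient.map₂ FinRep.tensor fun _ _ ⟨e⟩ _ _ ⟨f⟩ =>
    ⟨.mk (TensorProduct.congr e.toLinearEquiv f.toLinearEquiv) fun g =>
      TensorProduct.ext' fun v w =>
        congrArg₂ (· ⊗ₜ[ℂ] ·) (Representation.IntertwiningMap.isIntertwining _ _ e.toIntertwiningMap g v)
          (Representation.IntertwiningMap.isIntertwining _ _ f.toIntertwiningMap g w)⟩

instance : Zero (RepClass G) := ⟨Quotient.mk _ ⟨PUnit, .trivial ℂ G PUnit⟩⟩

instance : One (RepClass G) := ⟨Quotient.mk _ ⟨ℂ, .trivial ℂ G ℂ⟩⟩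

theorem RepClass.left_distrib' (a b c : RepClass G) : a * (b + c) = a * b + a * c := by
  induction a using Quotient.inductionOn with | _ U
  induction b using Quotient.inductionOn with | _ V
  induction c using Quotient.inductionOn with | _ W
  refine RepClass.sound (V := U.tensor (V.sum W)) (W := (U.tensor V).sum (U.tensor W))
    (TensorProduct.prodRight ℂ ℂ U.carrier V.carrier W.carrier) fun g x => ?_
  exact equivariant_of_tmul (TensorProduct.prodRight ℂ ℂ U.carrier V.carrier W.carrier).toLinearMap
    ((U.tensor (V.sum W)).ρ g) (((U.tensor V).sum (U.tensor W)).ρ g) (fun u w => rfl) x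

theorem RepClass.mul_comm' (a b : RepClass G) : a * b = b * a := by
  induction a using Quotient.inductionOn with | _ U
  induction b using Quotient.inductionOn with | _ V
  exact Quotient.sound ⟨Representation.TensorProduct.comm U.ρ V.ρ⟩

theorem RepClass.zero_mul' (a : RepClass G) : 0 * a = 0 := by
  induction a using Quotient.inductionOn with | _ U
  have : Subsingleton (PUnit.{1} ⊗[ℂ] U.carrier) := inferInstance
  refine RepClass.sound (V := FinRep.tensor ⟨PUnit, .trivial ℂ G PUnit⟩ U)
    (W := ⟨PUnit, .trivial ℂ G PUnit⟩)
    (LinearEquiv.ofSubsingleton (PUnit.{1} ⊗[ℂ] U.carrier) PUnit.{1}) fun g x => ?_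
  exact Subsingleton.elim (α := PUnit) _ _

/-- Isomorphism classes of representations form a commutative semiring under `⊕` and `⊗`. -/
instance : CommSemiring (RepClass G) where
  add_assoc a b c := by
    induction a using Quotient.inductionOn with | _ U
    induction b using Quotient.inductionOn with | _ V
    induction c using Quotient.inductionOn with | _ W
    exact RepClass.sound (V := (U.sum V).sum W) (W := U.sum (V.sum W))
      (LinearEquiv.prodAssoc ℂ U.carrier V.carrier W.carrier) fun g x => rfl
  zero_add a := by
    induction a using Quotient.inductionOn with | _ U
    exact RepClass.sound (V := FinRep.sum ⟨PUnit, .trivial ℂ G PUnit⟩ U) (W := U)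
      (LinearEquiv.uniqueProd (R := ℂ) (M := U.carrier) (M₂ := PUnit)) fun g x => rfl
  add_zero a := by
    induction a using Quotient.inductionOn with | _ U
    exact RepClass.sound (V := FinRep.sum U ⟨PUnit, .trivial ℂ G PUnit⟩) (W := U)
      (LinearEquiv.prodUnique (R := ℂ) (M := U.carrier) (M₂ := PUnit)) fun g x => rfl
  add_comm a b := by
    induction a using Quotient.inductionOn with | _ U
    induction b using Quotient.inductionOn with | _ V
    exact RepClass.sound (V := U.sum V) (W := V.sum U)
      (LinearEquiv.prodComm ℂ U.carrier V.carrier) fun g x => rfl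
  nsmul := nsmulRec
  left_distrib := RepClass.left_distrib'
  right_distrib a b c := by
    rw [RepClass.mul_comm', RepClass.left_distrib', RepClass.mul_comm' c a, RepClass.mul_comm' c b]
  zero_mul := RepClass.zero_mul'
  mul_zero a := (RepClass.mul_comm' a 0).trans (RepClass.zero_mul' a)
  mul_assoc a b c := by
    induction a using Quotient.inductionOn with | _ U
    induction b using Quotient.inductionOn with | _ V
    induction c using Quotient.inductionOn with | _ W
    exact Quotient.sound ⟨Representation.TensorProduct.assoc U.ρ V.ρ W.ρ⟩
  one_mul a := by
    induction a using Quotient.inductionOn with | _ U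
    exact Quotient.sound ⟨Representation.TensorProduct.lid ℂ U.ρ⟩
  mul_one a := by
    induction a using Quotient.inductionOn with | _ U
    exact Quotient.sound ⟨Representation.TensorProduct.rid ℂ U.ρ⟩
  mul_comm := RepClass.mul_comm'

/-- Restriction of a representation to a subgroup. -/
def FinRep.res (H : Subgroup G) (V : FinRep G) : FinRep H := ⟨V.carrier, V.ρ.comp H.subtype⟩

/-- Restriction on isomorphism classes. -/
def RepClass.res (H : Subgroup G) : RepClass G →+* RepClass H where
  toFun := Quotient.map (FinRep.res H) fun _ _ ⟨e⟩ =>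
    ⟨.mk e.toLinearEquiv fun g => LinearMap.ext fun v => Representation.IntertwiningMap.isIntertwining _ _ e.toIntertwiningMap g v⟩
  map_one' := rfl
  map_mul' a b := Quotient.inductionOn₂ a b fun _ _ => rfl
  map_zero' := rfl
  map_add' a b := Quotient.inductionOn₂ a b fun _ _ => rfl

variable (G) in
/-- The complex representation ring `R(G)`. -/
abbrev RepRing : Type (max 1 u) := Algebra.GrothendieckAddGroup (RepClass G)

/-- The restriction homomorphism `R(G) → R(H)`. -/
def RepRing.res (H : Subgroup G) : RepRing G →+* RepRing H := grothMap (RepClass.res H)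

/-- `R(H) ⊗ ℚ` as a module over `R(G) ⊗ ℚ`, through restriction of representations. -/
instance repRingRatModule (H : Subgroup G) :
    Module (RepRing G ⊗[ℤ] ℚ) (RepRing H ⊗[ℤ] ℚ) :=
  Module.compHom _ (Algebra.TensorProduct.map (RepRing.res H).toIntAlgHom
    (AlgHom.id ℤ ℚ)).toRingHom

end RepRing

/-! ### The group `K₀` of a ring -/

section KZero

/-- A finitely generated projective left `R`-module. -/
structure FGProj (R : Type u) [Ring R] where
  carrier : Type u
  [addCommGroup : AddCommGroup carrier]
  [module : Module R carrier]
  [finite : Module.Finite R carrier]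
  [projective : Module.Projective R carrier]

attribute [instance] FGProj.addCommGroup FGProj.module FGProj.finite FGProj.projective

variable (R : Type u) [Ring R]

instance FGProj.setoid : Setoid (FGProj R) where
  r E F := Nonempty (E.carrier ≃ₗ[R] F.carrier)
  iseqv := ⟨fun _ => ⟨.refl _ _⟩, fun ⟨e⟩ => ⟨e.symm⟩, fun ⟨e⟩ ⟨f⟩ => ⟨e.trans f⟩⟩

/-- Isomorphism classes of finitely generated projective left `R`-modules. -/
def ProjClass : Type (u + 1) := Quotient (FGProj.setoid R)

variable {R}

/-- Direct sum of finitely generated projective modules. -/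
def FGProj.sum (E F : FGProj R) : FGProj R := ⟨E.carrier × F.carrier⟩

/-- The zero module. -/
def FGProj.zero : FGProj R := ⟨PUnit⟩

instance : Add (ProjClass R) where
  add := Quotient.map₂ FGProj.sum fun _ _ ⟨e⟩ _ _ ⟨f⟩ => ⟨e.prodCongr f⟩

instance : Zero (ProjClass R) := ⟨Quotient.mk _ FGProj.zero⟩

/-- Isomorphism classes of finitely generated projective modules form a commutative monoid
under direct sum. -/
instance : AddCommMonoid (ProjClass R) where
  add_assoc a b c := by
    induction a using Quotient.inductionOn with | _ U
    induction b using Quotient.inductionOn with | _ V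
    induction c using Quotient.inductionOn with | _ W
    exact Quotient.sound ⟨LinearEquiv.prodAssoc R U.carrier V.carrier W.carrier⟩
  zero_add a := by
    induction a using Quotient.inductionOn with | _ U
    exact Quotient.sound
      ⟨(LinearEquiv.uniqueProd (R := R) (M := U.carrier) (M₂ := PUnit.{u + 1}) :)⟩
  add_zero a := by
    induction a using Quotient.inductionOn with | _ U
    exact Quotient.sound
      ⟨(LinearEquiv.prodUnique (R := R) (M := U.carrier) (M₂ := PUnit.{u + 1}) :)⟩
  add_comm a b := by
    induction a using Quotient.inductionOn with | _ U
    induction b using Quotient.inductionOn with | _ V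
    exact Quotient.sound ⟨LinearEquiv.prodComm R U.carrier V.carrier⟩
  nsmul := nsmulRec

variable (R) in
/-- `K₀(R)`, the Grothendieck group of finitely generated projective left `R`-modules. -/
abbrev K0 : Type (u + 1) := Algebra.GrothendieckAddGroup (ProjClass R)

end KZero

/-! ### The topological group `K₁` of a topological ring -/

section KOne

variable {R : Type u} [Ring R]

/-- The stabilization `u ↦ u ⊕ 1` from `m × m` to `k × k` matrices, for `m ≤ k`. -/
def stabMatrix (m k : ℕ) (u : Matrix (Fin m) (Fin m) R) : Matrix (Fin k) (Fin k) R :=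
  Matrix.of fun i j =>
    if h : (i : ℕ) < m ∧ (j : ℕ) < m then u ⟨i, h.1⟩ ⟨j, h.2⟩ else if i = j then 1 else 0

theorem stabMatrix_one (m k : ℕ) : stabMatrix m k (1 : Matrix (Fin m) (Fin m) R) = 1 := by
  ext i j
  simp only [stabMatrix, Matrix.of_apply, Matrix.one_apply, Fin.ext_iff]
  split_ifs <;> rfl

theorem stabMatrix_eq_fromBlocks (m d : ℕ) (u : Matrix (Fin m) (Fin m) R) :
    stabMatrix m (m + d) u =
      Matrix.reindex finSumFinEquiv finSumFinEquiv (Matrix.fromBlocks u 0 0 1) := by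
  ext i j
  obtain ⟨i, rfl⟩ := finSumFinEquiv.surjective i
  obtain ⟨j, rfl⟩ := finSumFinEquiv.surjective j
  rw [Matrix.reindex_apply, Matrix.submatrix_apply, Equiv.symm_apply_apply, Equiv.symm_apply_apply]
  rcases i with i | i <;> rcases j with j | j <;>
    simp [stabMatrix, Fin.ext_iff, Matrix.one_apply] <;> omega

theorem stabMatrix_mul {m k : ℕ} (h : m ≤ k) (u v : Matrix (Fin m) (Fin m) R) :
    stabMatrix m k (u * v) = stabMatrix m k u * stabMatrix m k v := by
  obtain ⟨d, rfl⟩ := Nat.exists_eq_add_of_le h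
  simp only [stabMatrix_eq_fromBlocks, Matrix.reindex_apply, Matrix.submatrix_mul_equiv,
    Matrix.fromBlocks_multiply]
  simp

theorem stabMatrix_self (m : ℕ) (u : Matrix (Fin m) (Fin m) R) : stabMatrix m m u = u := by
  ext i j
  simp [stabMatrix]

theorem stabMatrix_stabMatrix {m k l : ℕ} (h : m ≤ k) (u : Matrix (Fin m) (Fin m) R) :
    stabMatrix k l (stabMatrix m k u) = stabMatrix m l u := by
  ext i j
  simp only [stabMatrix, Matrix.of_apply, Fin.ext_iff]
  split_ifs <;> first | rfl | omega

/-- Stabilization `GL_m(R) → GL_k(R)`. -/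
def stabGL {m k : ℕ} (h : m ≤ k) :
    (Matrix (Fin m) (Fin m) R)ˣ →* (Matrix (Fin k) (Fin k) R)ˣ :=
  Units.map
    { toFun := stabMatrix m k
      map_one' := stabMatrix_one m k
      map_mul' := stabMatrix_mul h }

theorem continuous_stabGL [TopologicalSpace R] {m k : ℕ} (h : m ≤ k) : Continuous (stabGL (R := R) h) := by
  refine Continuous.units_map _ ?_
  refine continuous_matrix fun i j => ?_
  by_cases hij : (i : ℕ) < m ∧ (j : ℕ) < m
  · simpa [stabMatrix, hij] using! continuous_id.matrix_elem _ _
  · simpa [stabMatrix, hij] using! continuous_const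

variable [TopologicalSpace R] [IsTopologicalRing R]

variable (R) in
/-- `π₀(GL_m(R))`: invertible matrices modulo the path component of the identity. -/
abbrev PiZeroGL (m : ℕ) : Type u :=
  (Matrix (Fin m) (Fin m) R)ˣ ⧸ Subgroup.pathComponentOne (Matrix (Fin m) (Fin m) R)ˣ

variable (R) in
/-- Stabilization on path components. -/
def stabPiZero (m k : ℕ) (h : m ≤ k) : PiZeroGL R m →* PiZeroGL R k :=
  QuotientGroup.map _ _ (stabGL h) fun u hu => by
    have : Joined (stabGL (R := R) h 1) (stabGL h u) := Joined.map hu (continuous_stabGL h)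
    rwa [map_one] at this

instance : DirectedSystem (PiZeroGL R) (stabPiZero R · · ·) where
  map_self m x := by
    induction x using QuotientGroup.induction_on with | _ u
    refine congrArg QuotientGroup.mk (Units.ext ?_)
    exact stabMatrix_self m _
  map_map k m l h h' x := by
    induction x using QuotientGroup.induction_on with | _ u
    refine congrArg QuotientGroup.mk (Units.ext ?_)
    exact stabMatrix_stabMatrix h _

variable (R) in
/-- Topological `K₁` of a unital Banach (more generally, topological) algebra: the direct limit
of the groups `π₀(GL_m(R))`, written multiplicatively. -/
abbrev K1 : Type u := DirectLimit (PiZeroGL R) (stabPiZero R)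

end KOne

/-! ### Crossed products -/

section Crossed

open SkewMonoidAlgebra

/-- The topology of coefficientwise convergence on the crossed product. -/
instance crossedTopology {G A : Type*} [Ring A] [TopologicalSpace A] : TopologicalSpace (SkewMonoidAlgebra A G) :=
  TopologicalSpace.induced (fun f g => f.coeff g) inferInstance

/-- For a finite group acting continuously, the crossed product is a topological ring. -/
theorem crossed_isTopologicalRing {G : Type*} [Group G] {A : Type*} [Ring A]
    [MulSemiringAction G A] [Finite G] [TopologicalSpace A] [IsTopologicalRing A]
    [ContinuousConstSMul G A] : IsTopologicalRing (SkewMonoidAlgebra A G) := by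
  classical
  have := Fintype.ofFinite G
  have hc : ∀ g : G, Continuous fun f : SkewMonoidAlgebra A G => f.coeff g := fun g =>
    (continuous_apply g).comp continuous_induced_dom
  refine { continuous_add := ?_, continuous_mul := ?_, continuous_neg := ?_ }
  · refine continuous_induced_rng.2 (continuous_pi fun g => ?_)
    have : (fun p : SkewMonoidAlgebra A G × SkewMonoidAlgebra A G => (p.1 + p.2).coeff g) =
        fun p => p.1.coeff g + p.2.coeff g := by
      funext p
      rw [coeff_add, Finsupp.add_apply]
    exact this ▸ ((hc g).comp continuous_fst).add ((hc g).comp continuous_snd)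
  · refine continuous_induced_rng.2 (continuous_pi fun g => ?_)
    have : ((fun (f : SkewMonoidAlgebra A G) g => f.coeff g) ∘
        fun p : SkewMonoidAlgebra A G × SkewMonoidAlgebra A G => p.1 * p.2) = fun p g =>
        ∑ h : G, p.1.coeff h * h • p.2.coeff (h⁻¹ * g) := by
      funext p g
      simp only [Function.comp_apply, coeff_mul_left]
      rw [SkewMonoidAlgebra.sum_def', Finset.sum_subset (Finset.subset_univ _)]
      intro h _ hh
      rw [notMem_support_iff.1 hh, zero_mul]
    rw [this]
    refine continuous_finsetSum _ fun h _ => ?_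
    exact ((hc h).comp continuous_fst).mul (((hc _).comp continuous_snd).const_smul h)
  · refine continuous_induced_rng.2 (continuous_pi fun g => ?_)
    exact (hc g).neg

variable {G : Type u} [Group G] {A : Type v} [Ring A] [Algebra ℂ A] [MulSemiringAction G A]
  [SMulCommClass G ℂ A]

/-- Averaging over the finite group `G`: if `A` is semisimple, every surjection of modules over the
crossed product splits. -/
theorem crossed_split [Finite G] [IsSemisimpleRing A] {F P : Type*} [AddCommGroup F]
    [AddCommGroup P] [Module (SkewMonoidAlgebra A G) F] [Module (SkewMonoidAlgebra A G) P]
    (p : F →ₗ[SkewMonoidAlgebra A G] P) (hsurj : Function.Surjective p) :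
    ∃ T : P →ₗ[SkewMonoidAlgebra A G] F, p ∘ₗ T = LinearMap.id := by
  classical
  have := Fintype.ofFinite G
  let B := SkewMonoidAlgebra A G
  let ι : A →+* B := singleOneRingHom
  let : Module A P := Module.compHom P ι
  let : Module A F := Module.compHom F ι
  let pA : F →ₗ[A] P :=
    { toFun := p, map_add' := map_add p, map_smul' := fun a x => map_smul p (ι a) x }
  have hp : Function.Surjective pA := hsurj
  have := Module.projective_of_isSemisimpleRing A P
  obtain ⟨s, hs⟩ := Module.projective_lifting_property pA LinearMap.id hp
  have hs' : ∀ x, p (s x) = x := fun x => LinearMap.congr_fun hs x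
  have hsA : ∀ (a : A) x, s ((single 1 a : B) • x) = (single 1 a : B) • s x := fun a x =>
    map_smul s a x
  let c : B := algebraMap ℂ B ((Fintype.card G : ℂ)⁻¹)
  have hc : ∀ b : B, b * c = c * b := fun b => (Algebra.commutes _ b).symm
  let t : P →+ F :=
    { toFun := fun x => ∑ g : G, (single g 1 : B) • s ((single g⁻¹ 1 : B) • x)
      map_zero' := by simp
      map_add' := fun x y => by simp [Finset.sum_add_distrib] }
  have ht : ∀ (b : B) x, t (b • x) = b • t x := by
    intro b x
    induction b using SkewMonoidAlgebra.induction_on with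
    | zero => simp
    | add f g hf hg => rw [add_smul, map_add, hf, hg, add_smul]
    | single h a =>
      change ∑ g : G, (single g 1 : B) • s ((single g⁻¹ 1 : B) • (single h a : B) • x) =
        (single h a : B) • ∑ g : G, (single g 1 : B) • s ((single g⁻¹ 1 : B) • x)
      rw [Finset.smul_sum, ← Equiv.sum_comp (Equiv.mulLeft h)]
      refine Finset.sum_congr rfl fun g _ => ?_
      have h1 : (single (h * g)⁻¹ 1 : B) * single h a =
          single 1 ((h * g)⁻¹ • a) * single g⁻¹ 1 := by
        simp
      have h2 : (single (h * g) 1 : B) * single 1 ((h * g)⁻¹ • a) = single h a * single g 1 := by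
        simp [smul_smul]
      rw [Equiv.coe_mulLeft, smul_smul, h1, mul_smul, hsA, smul_smul, h2, mul_smul]
  let T : P →ₗ[B] F :=
    { toFun := fun x => c • t x
      map_add' := fun x y => by rw [map_add, smul_add]
      map_smul' := fun b x => by
        rw [ht, smul_smul, ← hc, mul_smul, RingHom.id_apply] }
  refine ⟨T, LinearMap.ext fun x => ?_⟩
  change p (c • ∑ g : G, (single g 1 : B) • s ((single g⁻¹ 1 : B) • x)) = x
  have h3 : ∀ g : G, (single g 1 : B) * single g⁻¹ 1 = 1 := fun g => by
    rw [single_mul_single]; simp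
  have h4 : c * (Fintype.card G : B) = 1 := by
    change algebraMap ℂ B _ * _ = 1
    rw [← map_natCast (algebraMap ℂ B), ← map_mul, inv_mul_cancel₀ (by simp), map_one]
  simp only [map_smul, _root_.map_sum, hs', smul_smul, h3, one_smul, Finset.sum_const, Finset.card_univ]
  rw [← Nat.cast_smul_eq_nsmul B, smul_smul, h4, one_smul]

/-- If `A` is semisimple, every module over the crossed product is projective. -/
theorem crossed_projective [Finite G] [IsSemisimpleRing A] (P : Type*) [AddCommGroup P]
    [Module (SkewMonoidAlgebra A G) P] : Module.Projective (SkewMonoidAlgebra A G) P := by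
  obtain ⟨T, hT⟩ := crossed_split (Finsupp.linearCombination (SkewMonoidAlgebra A G) (id : P → P))
    (Finsupp.linearCombination_id_surjective _ P)
  exact Module.Projective.of_split T _ hT

instance crossed_finite [Finite G] [Module.Finite ℂ A] : Module.Finite ℂ (SkewMonoidAlgebra A G) :=
  Module.Finite.equiv (SkewMonoidAlgebra.coeffLinearEquiv (S := ℂ) (k := A) (G := G)).symm

/-! ### Tensoring a module over the crossed product with a representation -/

section Twist

variable {V : Type*} [AddCommGroup V] [Module ℂ V] (ρ : Representation ℂ G V)
  (E : Type*) [AddCommGroup E] [Module ℂ E] [Module (SkewMonoidAlgebra A G) E]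
  [IsScalarTower ℂ (SkewMonoidAlgebra A G) E]

variable (A) in
/-- The action of the crossed product on `V ⊗ E`: `a ∈ A` acts by `1 ⊗ a` and `g ∈ G` acts
diagonally by `ρ(g) ⊗ g`. -/
def twistHom : SkewMonoidAlgebra A G →ₐ[ℂ] Module.End ℂ (V ⊗[ℂ] E) :=
  SkewMonoidAlgebra.liftNCAlgHom
    (((Module.End.lTensorAlgHom ℂ E V).comp
      (Algebra.lsmul ℂ ℂ E : SkewMonoidAlgebra A G →ₐ[ℂ] Module.End ℂ E)).comp
      { (singleOneRingHom : A →+* SkewMonoidAlgebra A G) with commutes' := fun _ => rfl })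
    { toFun := fun g =>
        TensorProduct.map (ρ g) (Algebra.lsmul ℂ ℂ E (SkewMonoidAlgebra.of A G g))
      map_one' := by simp [TensorProduct.map_one]
      map_mul' := fun g h => by simp only [map_mul, TensorProduct.map_mul] }
    (by
      intro a g
      refine TensorProduct.ext' fun v e => ?_
      change ρ g v ⊗ₜ[ℂ] ((single 1 (g • a) : SkewMonoidAlgebra A G) •
        (SkewMonoidAlgebra.of A G g • e)) =
        ρ g v ⊗ₜ[ℂ] (SkewMonoidAlgebra.of A G g • (single 1 a : SkewMonoidAlgebra A G) • e)
      rw [smul_smul, smul_smul, of_apply]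
      simp)

theorem twistHom_single (g : G) (a : A) (v : V) (e : E) :
    twistHom A ρ E (single g a) (v ⊗ₜ e) =
      ρ g v ⊗ₜ[ℂ] ((single g a : SkewMonoidAlgebra A G) • e) := by
  have h : twistHom A ρ E (single g a) (v ⊗ₜ e) =
      ρ g v ⊗ₜ[ℂ] ((single 1 a : SkewMonoidAlgebra A G) • (SkewMonoidAlgebra.of A G g • e)) :=
    LinearMap.congr_fun (SkewMonoidAlgebra.liftNC_single _ _ g a) (v ⊗ₜ e)
  rw [h, smul_smul, of_apply]
  simp

end Twist

/-- The underlying complex vector space of a module over the crossed product. -/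
instance crossedComplexModule (E : FGProj (SkewMonoidAlgebra A G)) : Module ℂ E.carrier :=
  Module.compHom E.carrier (algebraMap ℂ (SkewMonoidAlgebra A G))

instance crossedScalarTower (E : FGProj (SkewMonoidAlgebra A G)) :
    IsScalarTower ℂ (SkewMonoidAlgebra A G) E.carrier where
  smul_assoc c b x := by
    rw [Algebra.smul_def, mul_smul]
    rfl

variable [Finite G] [Module.Finite ℂ A] [IsSemisimpleRing A]

/-- The module `V ⊗ E` over the crossed product, for a representation `V` of `G` and a
finitely generated projective module `E`. -/
def twist (V : FinRep G) (E : FGProj (SkewMonoidAlgebra A G)) :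
    FGProj (SkewMonoidAlgebra A G) :=
  letI : Module (SkewMonoidAlgebra A G) (V.carrier ⊗[ℂ] E.carrier) :=
    Module.compHom _ (twistHom A V.ρ E.carrier).toRingHom
  haveI : IsScalarTower ℂ (SkewMonoidAlgebra A G) (V.carrier ⊗[ℂ] E.carrier) :=
    ⟨fun c b x => LinearMap.congr_fun (map_smul (twistHom A V.ρ E.carrier) c b) x⟩
  haveI : Module.Finite ℂ E.carrier := Module.Finite.trans (SkewMonoidAlgebra A G) E.carrier
  haveI : Module.Finite (SkewMonoidAlgebra A G) (V.carrier ⊗[ℂ] E.carrier) :=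
    Module.Finite.of_restrictScalars_finite ℂ _ _
  haveI : Module.Projective (SkewMonoidAlgebra A G) (V.carrier ⊗[ℂ] E.carrier) :=
    crossed_projective _
  ⟨V.carrier ⊗[ℂ] E.carrier⟩

/-- An additive bijection `V ⊗ E ≃ F` is an isomorphism of modules over the crossed product as
soon as it commutes with the elements `a g` on pure tensors. -/
theorem twist_equiv {V : FinRep G} {E F : FGProj (SkewMonoidAlgebra A G)}
    (e : V.carrier ⊗[ℂ] E.carrier ≃+ F.carrier)
    (h : ∀ (g : G) (a : A) v x, e (V.ρ g v ⊗ₜ[ℂ] ((single g a : SkewMonoidAlgebra A G) • x)) =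
      (single g a : SkewMonoidAlgebra A G) • e (v ⊗ₜ[ℂ] x)) :
    Nonempty ((twist V E).carrier ≃ₗ[SkewMonoidAlgebra A G] F.carrier) := by
  have key : ∀ (b : SkewMonoidAlgebra A G) (x : V.carrier ⊗[ℂ] E.carrier),
      e (twistHom A V.ρ E.carrier b x) = b • e x := by
    intro b x
    induction b using SkewMonoidAlgebra.induction_on with
    | zero => simp
    | add f g hf hg => rw [map_add, LinearMap.add_apply, map_add, hf, hg, add_smul]
    | single g a =>
      induction x using TensorProduct.induction_on with
      | zero => simp
      | add x y hx hy => rw [map_add, map_add, hx, hy, map_add, smul_add]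
      | tmul v x => rw [twistHom_single, h]
  exact ⟨{ e with map_smul' := key }⟩

theorem twist_smul_tmul (V : FinRep G) (E : FGProj (SkewMonoidAlgebra A G)) (g : G) (a : A)
    (v : V.carrier) (x : E.carrier) :
    (single g a : SkewMonoidAlgebra A G) • (show (twist V E).carrier from v ⊗ₜ[ℂ] x) =
      (show (twist V E).carrier from
        V.ρ g v ⊗ₜ[ℂ] ((single g a : SkewMonoidAlgebra A G) • x)) :=
  twistHom_single V.ρ E.carrier g a v x

/-- `V ⊗ E`, with the scalar structure of the tensor product, is the underlying vector space of
the twisted module. -/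
def twistComplexEquiv (V : FinRep G) (E : FGProj (SkewMonoidAlgebra A G)) :
    V.carrier ⊗[ℂ] E.carrier ≃ₗ[ℂ] (twist V E).carrier where
  __ := AddEquiv.refl (V.carrier ⊗[ℂ] E.carrier)
  map_smul' c x :=
    (LinearMap.congr_fun ((twistHom A V.ρ E.carrier).commutes c) x).symm

instance : SMul (RepClass G) (ProjClass (SkewMonoidAlgebra A G)) where
  smul := Quotient.map₂ twist fun V V' ⟨e⟩ E E' ⟨f⟩ =>
    twist_equiv (V := V) (E := E) (F := twist V' E')
      (TensorProduct.congr e.toLinearEquiv (f.restrictScalars ℂ)).toAddEquiv fun g a v x => by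
      refine Eq.trans ?_ (twist_smul_tmul V' E' g a (e v) (f x)).symm
      exact congrArg₂ (· ⊗ₜ[ℂ] ·)
        (Representation.IntertwiningMap.isIntertwining _ _ e.toIntertwiningMap g v)
        (f.map_smul _ x)

/-- Isomorphism classes of finitely generated projective modules over the crossed product form a
semimodule over the semiring of isomorphism classes of representations. -/
instance : Module (RepClass G) (ProjClass (SkewMonoidAlgebra A G)) where
  one_smul b := by
    induction b using Quotient.inductionOn with | _ E
    refine Quotient.sound (twist_equiv (V := ⟨ℂ, .trivial ℂ G ℂ⟩) (E := E) (F := E)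
      (TensorProduct.lid ℂ E.carrier).toAddEquiv fun g a v x => ?_)
    exact (smul_comm (single g a : SkewMonoidAlgebra A G) v x).symm
  mul_smul r s b := by
    induction r using Quotient.inductionOn with | _ V
    induction s using Quotient.inductionOn with | _ W
    induction b using Quotient.inductionOn with | _ E
    refine Quotient.sound (twist_equiv (V := V.tensor W) (E := E) (F := twist V (twist W E))
      ((TensorProduct.assoc ℂ V.carrier W.carrier E.carrier).trans
        (TensorProduct.congr (.refl ℂ V.carrier) (twistComplexEquiv W E))).toAddEquiv
      fun g a t x => ?_)
    generalize he : ((TensorProduct.assoc ℂ V.carrier W.carrier E.carrier).trans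
        (TensorProduct.congr (.refl ℂ V.carrier) (twistComplexEquiv W E))).toAddEquiv = e
    have hlin : ∀ t : V.carrier ⊗[ℂ] W.carrier,
        e ((V.ρ.tprod W.ρ) g t ⊗ₜ[ℂ] ((single g a : SkewMonoidAlgebra A G) • x)) =
          (show (twist V (twist W E)).carrier from
            (single g a : SkewMonoidAlgebra A G) •
              (show (twist V (twist W E)).carrier from e (t ⊗ₜ[ℂ] x))) := by
      intro t
      induction t using TensorProduct.induction_on with
      | zero =>
        rw [map_zero, TensorProduct.zero_tmul, TensorProduct.zero_tmul, map_zero]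
        exact (smul_zero (A := (twist V (twist W E)).carrier) _).symm
      | add x y hx hy =>
        rw [map_add, TensorProduct.add_tmul, TensorProduct.add_tmul, map_add, map_add, hx, hy]
        exact (smul_add (A := (twist V (twist W E)).carrier) _ _ _).symm
      | tmul v w =>
        subst he
        refine Eq.trans ?_ (twist_smul_tmul V (twist W E) g a v (w ⊗ₜ[ℂ] x)).symm
        exact congrArg (V.ρ g v ⊗ₜ[ℂ] ·) (twist_smul_tmul W E g a w x).symm
    exact hlin t
  smul_zero r := by
    induction r using Quotient.inductionOn with | _ V
    have : Subsingleton (FGProj.zero (R := SkewMonoidAlgebra A G)).carrier :=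
      inferInstanceAs (Subsingleton PUnit)
    have : Subsingleton (V.carrier ⊗[ℂ] (FGProj.zero (R := SkewMonoidAlgebra A G)).carrier) :=
      inferInstance
    refine Quotient.sound (twist_equiv (V := V) (E := FGProj.zero) (F := FGProj.zero)
      { toFun := fun _ => 0, invFun := fun _ => 0, left_inv := fun _ => Subsingleton.elim _ _,
        right_inv := fun _ => Subsingleton.elim _ _,
        map_add' := fun _ _ => Subsingleton.elim _ _ } fun g a v x => Subsingleton.elim _ _)
  smul_add r b c := by
    induction r using Quotient.inductionOn with | _ V
    induction b using Quotient.inductionOn with | _ E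
    induction c using Quotient.inductionOn with | _ F
    refine Quotient.sound (twist_equiv (V := V) (E := E.sum F) (F := (twist V E).sum (twist V F))
      (TensorProduct.prodRight ℂ ℂ V.carrier E.carrier F.carrier).toAddEquiv fun g a v x => ?_)
    exact (Prod.ext (twist_smul_tmul V E g a v x.1) (twist_smul_tmul V F g a v x.2)).symm
  add_smul r s b := by
    induction r using Quotient.inductionOn with | _ V
    induction s using Quotient.inductionOn with | _ W
    induction b using Quotient.inductionOn with | _ E
    refine Quotient.sound (twist_equiv (V := V.sum W) (E := E) (F := (twist V E).sum (twist W E))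
      (TensorProduct.prodLeft ℂ ℂ V.carrier W.carrier E.carrier).toAddEquiv fun g a v x => ?_)
    exact (Prod.ext (twist_smul_tmul V E g a v.1 x) (twist_smul_tmul W E g a v.2 x)).symm
  zero_smul b := by
    induction b using Quotient.inductionOn with | _ E
    have : Subsingleton (FGProj.zero (R := SkewMonoidAlgebra A G)).carrier :=
      inferInstanceAs (Subsingleton PUnit)
    have : Subsingleton (PUnit.{1} ⊗[ℂ] E.carrier) := inferInstance
    refine Quotient.sound (twist_equiv (V := ⟨PUnit, .trivial ℂ G PUnit⟩) (E := E)
      (F := FGProj.zero)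
      { toFun := fun _ => 0, invFun := fun _ => 0, left_inv := fun _ => Subsingleton.elim _ _,
        right_inv := fun _ => Subsingleton.elim _ _,
        map_add' := fun _ _ => Subsingleton.elim _ _ } fun g a v x => Subsingleton.elim _ _)

/-- `K₀` of the crossed product as a module over the representation ring: the class of `V` acts on
the class of `E` as the class of `V ⊗ E`. -/
instance crossedK0Module : Module (RepRing G) (K0 (SkewMonoidAlgebra A G)) :=
  grothModule (RepClass G) (ProjClass (SkewMonoidAlgebra A G))

/-- `K₀ ⊗ ℚ` as a module over `R(G) ⊗ ℚ`, with `(r ⊗ p) • (x ⊗ q) = (r • x) ⊗ (p q)`. -/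
instance crossedK0RatModule :
    Module (RepRing G ⊗[ℤ] ℚ) (K0 (SkewMonoidAlgebra A G) ⊗[ℤ] ℚ) :=
  Module.compHom _ ((Module.endTensorEndAlgHom (R := ℤ) (S := ℤ) (A := ℤ)
    (M := K0 (SkewMonoidAlgebra A G)) (N := ℚ)).comp
    (Algebra.TensorProduct.map (Algebra.lsmul ℤ ℤ (K0 (SkewMonoidAlgebra A G)))
      (Algebra.lsmul ℤ ℤ ℚ))).toRingHom

end Crossed

/-! ### Actions of a finite group on a matrix algebra -/

section MatrixAction

variable (G : Type u) [Group G] (n : ℕ) [MulSemiringAction G (Matrix (Fin n) (Fin n) ℂ)]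

/-- The crossed product `G ⋉ M_n(ℂ)`: formal sums `∑ a_g g` with `(a g) (b h) = a g(b) (g h)`. -/
abbrev CrossedProduct : Type u := SkewMonoidAlgebra (Matrix (Fin n) (Fin n) ℂ) G

instance matrixContinuousConstSMul [SMulCommClass G ℂ (Matrix (Fin n) (Fin n) ℂ)] :
    ContinuousConstSMul G (Matrix (Fin n) (Fin n) ℂ) where
  continuous_const_smul g :=
    (DistribSMul.toLinearMap ℂ (Matrix (Fin n) (Fin n) ℂ) g).continuous_of_finiteDimensional

instance crossedProductTopologicalRing [Finite G]
    [SMulCommClass G ℂ (Matrix (Fin n) (Fin n) ℂ)] : IsTopologicalRing (CrossedProduct G n) :=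
  crossed_isTopologicalRing

/-- The pull-back `G̃` of `SL_n(ℂ) → PGL_n(ℂ) = Aut(M_n(ℂ))` along the action of `G`: pairs
`(g, u)` such that `g` acts on `M_n(ℂ)` as conjugation by `u`. If `G` acts by `*`-automorphisms,
i.e. through `PU(n)`, such a `u` lies in `SU(n)`. -/
def centralExtension : Subgroup (G × Matrix.SpecialLinearGroup (Fin n) ℂ) where
  carrier := {p | ∀ a : Matrix (Fin n) (Fin n) ℂ,
    p.1 • a = (p.2 : Matrix (Fin n) (Fin n) ℂ) * a * ((p.2⁻¹ :) : Matrix (Fin n) (Fin n) ℂ)}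
  one_mem' a := by simp
  mul_mem' {p q} hp hq a := by
    rw [Prod.fst_mul, mul_smul, hq, hp, Prod.snd_mul, mul_inv_rev,
      Matrix.SpecialLinearGroup.coe_mul, Matrix.SpecialLinearGroup.coe_mul]
    simp only [mul_assoc]
  inv_mem' {p} hp a := by
    rw [Prod.fst_inv, inv_smul_eq_iff, hp, Prod.snd_inv, inv_inv]
    have h : (p.2 : Matrix (Fin n) (Fin n) ℂ) * ((p.2⁻¹ :) : Matrix (Fin n) (Fin n) ℂ) = 1 := by
      rw [← Matrix.SpecialLinearGroup.coe_mul, mul_inv_cancel, Matrix.SpecialLinearGroup.coe_one]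
    simp only [← mul_assoc, h, one_mul]
    rw [mul_assoc, h, mul_one]

/-- The image in `G` of the center of `G̃`. -/
def centerImage : Subgroup G :=
  (Subgroup.center (centralExtension G n)).map
    ((MonoidHom.fst G (Matrix.SpecialLinearGroup (Fin n) ℂ)).comp (centralExtension G n).subtype)

end MatrixAction

end TwistedK

end

/-!
`GL_m` of a finite-dimensional algebra is path connected, since the complex line through `1` and a
unit contains only finitely many non-units; hence `K₁ = 0`.

Any two simple modules over the crossed product differ by a twist with a character of `G`: the maps
between them that are linear over `M_n(ℂ)` form a representation of the abelian group `G`, non-zero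
since `M_n(ℂ)` is simple, and an eigenvector of it is an isomorphism up to a character. So the
characters of `G` act transitively on the simple classes, which form a basis of `K₀`.

Write the action of `g` as conjugation by `u_g`. The stabilizer of a simple class consists of the
characters `χ` for which some `u_h` satisfies `g(u_h) = χ(g) u_h` for all `g`: multiplication by
`u_h⁻¹ h`, which commutes with `M_n(ℂ)`, is an isomorphism from the module to its twist. By duality
of finite abelian groups this stabilizer is the annihilator of `G'`, because `g` lies in `G'` iff
`u_g` commutes with all the `u_h`. Thus the simple classes form a torsor under the characters of
`G'`, and `K₀` is isomorphic to `R(G')`.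
-/

noncomputable section

namespace TwistedK

universe u v

open Algebra (GrothendieckAddGroup)

section UnitsConnected

theorem finite_setOf_not_isUnit_lineMap_one {K C : Type*} [Field K] [Ring C] [Algebra K C]
    [Module.Finite K C] (x : C) :
    {t : K | ¬ IsUnit (AffineMap.lineMap 1 x t : C)}.Finite := by
  refine ((Module.End.finite_spectrum (Algebra.lmul K C (1 - x))).image (·⁻¹)).subset
    fun t (ht : ¬ _) => ⟨t⁻¹, fun hu => ht ?_, inv_inv t⟩
  have ht0 : t ≠ 0 := by
    rintro rfl
    simp at ht
  have hline : (AffineMap.lineMap 1 x t : C) = t • (algebraMap K C t⁻¹ - (1 - x)) := by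
    rw [AffineMap.lineMap_apply_module', Algebra.algebraMap_eq_smul_one,
      smul_sub t (t⁻¹ • 1), smul_inv_smul₀ ht0, smul_sub, smul_sub]
    abel
  rw [spectrum.mem_resolventSet_iff, ← AlgHom.commutes (Algebra.lmul K C), ← map_sub,
    Algebra.lmul_isUnit_iff] at hu
  rw [hline]
  exact hu.smul (Units.mk0 t ht0)

theorem continuous_units_of_continuous_val {X C : Type*} [TopologicalSpace X] [Ring C]
    [Algebra ℂ C] [Module.Finite ℂ C] [TopologicalSpace C] [IsTopologicalRing C]
    [ContinuousSMul ℂ C] [T2Space C] {f : X → Cˣ} (hf : Continuous fun s => (f s : C)) :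
    Continuous f := by
  let b := Module.finBasis ℂ C
  let L := Algebra.leftMulMatrix b
  have hL : Continuous L := LinearMap.continuous_of_finiteDimensional L.toLinearMap
  have hinv : Continuous fun s => L (↑(f s)⁻¹ : C) := by
    have hL_inv : ∀ s, L (↑(f s)⁻¹ : C) = (L (f s))⁻¹ := fun s =>
      (Matrix.inv_eq_right_inv (by rw [← map_mul, Units.mul_inv, map_one])).symm
    have hdet : ∀ s, IsUnit (L (f s)).det := fun s =>
      (Matrix.isUnit_iff_isUnit_det _).1 ((f s).isUnit.map L)
    simp only [hL_inv]
    exact continuous_iff_continuousAt.2 fun s =>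
      (continuousAt_matrix_inv _ (NormedRing.inverse_continuousAt (hdet s).unit)).comp
        (f := fun s => L (f s)) (hL.comp hf).continuousAt
  let Φ : Matrix _ _ ℂ →ₗ[ℂ] C :=
    b.equivFun.symm.toLinearMap ∘ₗ (Matrix.mulVecBilin ℂ ℂ).flip (b.equivFun 1)
  have hΦ : ∀ y, Φ (L y) = y := fun y => by
    change b.equivFun.symm ((L y).mulVec (b.repr 1)) = y
    rw [Algebra.leftMulMatrix_mulVec_repr, ← b.equivFun_apply, LinearEquiv.symm_apply_apply,
      mul_one]
  refine Units.continuous_iff.2 ⟨hf, ?_⟩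
  simpa only [hΦ, Function.comp_def] using (LinearMap.continuous_of_finiteDimensional Φ).comp hinv

instance units_pathConnectedSpace {C : Type*} [Ring C] [Algebra ℂ C] [Module.Finite ℂ C]
    [TopologicalSpace C] [IsTopologicalRing C] [ContinuousSMul ℂ C] [T2Space C] :
    PathConnectedSpace Cˣ := by
  have joined_one : ∀ x : Cˣ, Joined 1 x := fun x => by
    obtain ⟨γ, hγ⟩ := ((finite_setOf_not_isUnit_lineMap_one (K := ℂ) (x : C)).countable
      |>.isPathConnected_compl_of_one_lt_rank
        (by rw [Complex.rank_real_complex]; exact Nat.one_lt_ofNat)).joinedIn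
      0 (by simp) 1 (by simp)
    have hu : ∀ s, IsUnit (AffineMap.lineMap 1 (x : C) (γ s) : C) := fun s => not_not.1 (hγ s)
    have hc : Continuous fun s => (AffineMap.lineMap 1 (x : C) (γ s) : C) := by
      simp only [AffineMap.lineMap_apply_module']
      fun_prop
    exact ⟨⟨⟨fun s => (hu s).unit, continuous_units_of_continuous_val hc⟩,
      Units.ext (by simp), Units.ext (by simp)⟩⟩
  exact ⟨⟨1⟩, fun x y => (joined_one x).symm.trans (joined_one y)⟩

theorem crossed_continuous_coeff {G A : Type*} [Ring A] [TopologicalSpace A] (g : G) :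
    Continuous fun f : SkewMonoidAlgebra A G => f.coeff g :=
  (continuous_apply g).comp continuous_induced_dom

instance crossed_continuousSMul {G A : Type*} [Ring A] [Algebra ℂ A]
    [TopologicalSpace A] [ContinuousSMul ℂ A] : ContinuousSMul ℂ (SkewMonoidAlgebra A G) where
  continuous_smul := continuous_induced_rng.2 <| continuous_pi fun g =>
    continuous_fst.smul ((crossed_continuous_coeff g).comp continuous_snd)

instance crossed_t2Space {G A : Type*} [Ring A] [TopologicalSpace A] [T2Space A] :
    T2Space (SkewMonoidAlgebra A G) :=
  .of_injective_continuous (f := fun f g => f.coeff g)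
    (fun _ _ h => SkewMonoidAlgebra.coeff_injective (Finsupp.ext (congrFun h)))
    continuous_induced_dom

theorem subsingleton_K1 (R : Type u) [Ring R] [Algebra ℂ R] [Module.Finite ℂ R]
    [TopologicalSpace R] [IsTopologicalRing R] [ContinuousSMul ℂ R] [T2Space R] :
    Subsingleton (K1 R) := by
  have hone : ∀ (m : ℕ) (y : PiZeroGL R m), y = 1 := fun m y => by
    induction y using QuotientGroup.induction_on with | _ x
    exact (QuotientGroup.eq_one_iff x).2 (PathConnectedSpace.joined 1 x)
  refine ⟨fun x y => ?_⟩
  obtain ⟨m, x, y, rfl, rfl⟩ := DirectLimit.exists_eq_mk₂ (stabPiZero R) x y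
  rw [hone m x, hone m y]

end UnitsConnected

section Groth

variable {X M : Type*} [AddCommMonoid M] {b : X → M}

theorem linearIndependent_groth_of {m : X → M →+ ℕ} (h_self : ∀ x, m x (b x) = 1)
    (h_ne : Pairwise fun x y => m x (b y) = 0) :
    LinearIndependent ℤ fun x => GrothendieckAddGroup.of (b x) := by
  let F : X → GrothendieckAddGroup M →+ ℤ := fun x =>
    GrothendieckAddGroup.lift ((Nat.castAddMonoidHom ℤ).comp (m x))
  have hF : ∀ x y, F x (GrothendieckAddGroup.of (b y)) = m x (b y) := fun x y =>
    groth_lift_of _ _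
  refine .of_pairwise_dual_eq_zero_one _ (fun x => (F x).toIntLinearMap) (fun x y hxy => ?_)
    fun x => ?_
  · exact (hF x y).trans (by rw [h_ne hxy, Nat.cast_zero])
  · exact (hF x x).trans (by rw [h_self, Nat.cast_one])

theorem span_groth_of_eq_top (hb : AddSubmonoid.closure (Set.range b) = ⊤) :
    Submodule.span ℤ (Set.range fun x => GrothendieckAddGroup.of (b x)) = ⊤ := by
  rw [Submodule.eq_top_iff']
  intro y
  induction y using groth_induction with
  | hsub y z hy hz => exact sub_mem hy hz
  | h a =>
    induction hb ▸ AddSubmonoid.mem_top a using AddSubmonoid.closure_induction with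
    | mem a ha =>
      obtain ⟨x, rfl⟩ := ha
      exact Submodule.subset_span ⟨x, rfl⟩
    | zero => rw [map_zero]; exact zero_mem _
    | add a c _ _ ha hc => rw [map_add]; exact add_mem ha hc

/-- The basis of the Grothendieck group of `M` given by generators `b x` of `M` for which there are
additive multiplicity functions `m x`, dual to `b`. -/
def grothBasis {m : X → M →+ ℕ} (h_self : ∀ x, m x (b x) = 1)
    (h_ne : Pairwise fun x y => m x (b y) = 0) (hb : AddSubmonoid.closure (Set.range b) = ⊤) :
    Module.Basis X ℤ (GrothendieckAddGroup M) :=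
  .mk (linearIndependent_groth_of h_self h_ne) (span_groth_of_eq_top hb).ge

theorem grothBasis_apply {m : X → M →+ ℕ} (h_self : ∀ x, m x (b x) = 1)
    (h_ne : Pairwise fun x y => m x (b y) = 0) (hb : AddSubmonoid.closure (Set.range b) = ⊤)
    (x : X) : grothBasis h_self h_ne hb x = GrothendieckAddGroup.of (b x) := by
  rw [grothBasis, Module.Basis.mk_apply]

theorem closure_eq_top_of_exists_add {ι W : Type*} [LT W] [WellFoundedLT W] {s : Set M}
    {cls : ι → M} (hcls : Function.Surjective cls) (size : ι → W)
    (h : ∀ i, cls i = 0 ∨ ∃ b ∈ s, ∃ j, size j < size i ∧ cls i = b + cls j) :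
    AddSubmonoid.closure s = ⊤ := by
  have mem_closure : ∀ i, cls i ∈ AddSubmonoid.closure s := fun i => by
    induction i using (InvImage.wf size wellFounded_lt).induction with | _ i ih
    obtain h0 | ⟨b, hb, j, hj, hij⟩ := h i
    · exact h0 ▸ zero_mem _
    · exact hij ▸ add_mem (AddSubmonoid.subset_closure hb) (ih j hj)
  exact eq_top_iff.2 fun a _ => (hcls a).elim fun i hi => hi ▸ mem_closure i

end Groth

section Characters

variable {H : Type u} [Group H]

/-- The one-dimensional representation attached to a character. -/
def charRep (χ : H →* ℂˣ) : FinRep H where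
  carrier := ℂ
  ρ := (Algebra.lsmul ℂ ℂ ℂ : ℂ →ₐ[ℂ] Module.End ℂ ℂ).toMonoidHom.comp
    ((Units.coeHom ℂ).comp χ)

/-- The isomorphism class of a representation. -/
def RepClass.mk (V : FinRep H) : RepClass H := Quotient.mk _ V

/-- The isomorphism class of the one-dimensional representation attached to a character. -/
def charClass (χ : H →* ℂˣ) : RepClass H := RepClass.mk (charRep χ)

theorem charClass_mul (χ ψ : H →* ℂˣ) : charClass (χ * ψ) = charClass χ * charClass ψ := by
  refine (RepClass.sound (V := (charRep χ).tensor (charRep ψ)) (W := charRep (χ * ψ))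
    (TensorProduct.lid ℂ ℂ) fun g x => ?_).symm
  refine equivariant_of_tmul (TensorProduct.lid ℂ ℂ).toLinearMap
    (((charRep χ).tensor (charRep ψ)).ρ g) ((charRep (χ * ψ)).ρ g) (fun z w => ?_) x
  change ((χ g : ℂ) * z) * ((ψ g : ℂ) * w) = ((χ g * ψ g : ℂˣ) : ℂ) * (z * w)
  rw [Units.val_mul]
  ring

theorem charClass_one : charClass (1 : H →* ℂˣ) = 1 :=
  RepClass.sound (V := charRep 1) (W := ⟨ℂ, .trivial ℂ H ℂ⟩) (.refl ℂ ℂ)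
    fun _ (z : ℂ) => one_mul z

variable {V W : Type*} [AddCommGroup V] [Module ℂ V] [AddCommGroup W] [Module ℂ W]
  (ρ : Representation ℂ H V) {σ : Representation ℂ H W} {χ ψ : H →* ℂˣ}

/-- The subspace on which the group acts through the character `χ`. -/
def weightSpace (χ : H →* ℂˣ) : Submodule ℂ V where
  carrier := {v | ∀ h, ρ h v = (χ h : ℂ) • v}
  zero_mem' h := by simp
  add_mem' hv hw h := by rw [map_add, hv h, hw h, smul_add]
  smul_mem' c v hv h := by rw [map_smul, hv h, smul_comm]

theorem mem_weightSpace {v : V} : v ∈ weightSpace ρ χ ↔ ∀ h, ρ h v = (χ h : ℂ) • v := Iff.rfl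

variable {ρ} in
theorem map_weightSpace (e : ρ.Equiv σ) :
    (weightSpace ρ χ).map e.toLinearEquiv.toLinearMap = weightSpace σ χ := by
  have he : ∀ h v, e.toLinearEquiv (ρ h v) = σ h (e.toLinearEquiv v) :=
    e.toIntertwiningMap.isIntertwining
  ext w
  obtain ⟨v, rfl⟩ := e.toLinearEquiv.surjective w
  rw [Submodule.map_equiv_eq_comap_symm, Submodule.mem_comap]
  simp only [LinearEquiv.coe_coe, LinearEquiv.symm_apply_apply, mem_weightSpace, ← he, ← map_smul,
    e.toLinearEquiv.injective.eq_iff]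

variable (σ) in
theorem weightSpace_prod (χ : H →* ℂˣ) :
    weightSpace (ρ.prod σ) χ = (weightSpace ρ χ).prod (weightSpace σ χ) := by
  ext x
  simp only [mem_weightSpace, Submodule.mem_prod, ← forall_and]
  exact forall_congr' fun h => Prod.ext_iff

theorem weightSpace_charRep_self (χ : H →* ℂˣ) : weightSpace (charRep χ).ρ χ = ⊤ :=
  eq_top_iff.2 fun _ _ _ => rfl

theorem weightSpace_charRep_of_ne (h : χ ≠ ψ) : weightSpace (charRep ψ).ρ χ = ⊥ := by
  rw [eq_bot_iff]
  intro (z : ℂ) hz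
  by_contra hz0
  refine h (MonoidHom.ext fun k => Units.ext ?_)
  have hk : (ψ k : ℂ) * z = (χ k : ℂ) * z := hz k
  have hz1 : z ≠ (0 : ℂ) := hz0
  exact (mul_right_cancel₀ hz1 hk).symm

/-- The multiplicity of a character in a representation. -/
def weightMult (χ : H →* ℂˣ) : RepClass H →+ ℕ where
  toFun := Quotient.lift (fun V : FinRep H => Module.finrank ℂ (weightSpace V.ρ χ)) (by
    rintro V W ⟨e⟩
    rw [← map_weightSpace e, LinearEquiv.finrank_map_eq])
  map_zero' := by
    change Module.finrank ℂ (weightSpace (Representation.trivial ℂ H PUnit.{1}) χ) = 0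
    exact Module.finrank_zero_of_subsingleton
  map_add' a b := by
    induction a using Quotient.inductionOn with | _ V
    induction b using Quotient.inductionOn with | _ W
    change Module.finrank ℂ (weightSpace (V.ρ.prod W.ρ) χ) =
      Module.finrank ℂ (weightSpace V.ρ χ) + Module.finrank ℂ (weightSpace W.ρ χ)
    rw [← Module.finrank_prod, weightSpace_prod]
    exact LinearEquiv.finrank_eq
      { toFun := fun x => (⟨x.1.1, x.2.1⟩, ⟨x.1.2, x.2.2⟩)
        invFun := fun x => ⟨(x.1, x.2), x.1.2, x.2.2⟩
        map_add' := fun _ _ => rfl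
        map_smul' := fun _ _ => rfl }

theorem weightMult_charClass_self (χ : H →* ℂˣ) : weightMult χ (charClass χ) = 1 := by
  change Module.finrank ℂ (weightSpace (charRep χ).ρ χ) = 1
  rw [weightSpace_charRep_self, finrank_top]
  exact Module.finrank_self ℂ

theorem weightMult_charClass_of_ne (h : χ ≠ ψ) : weightMult χ (charClass ψ) = 0 := by
  change Module.finrank ℂ (weightSpace (charRep ψ).ρ χ) = 0
  rw [weightSpace_charRep_of_ne h, finrank_bot]

end Characters

section WeightProj

variable {H : Type u} [CommGroup H] [Finite H] {V : Type*} [AddCommGroup V] [Module ℂ V]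
  (ρ : Representation ℂ H V) {χ : H →* ℂˣ}

theorem sum_characters_apply_eq_zero [Fintype (H →* ℂˣ)] {h : H} (hh : h ≠ 1) :
    ∑ χ : H →* ℂˣ, (χ h : ℂ) = 0 := by
  refine sum_hom_units_eq_zero ((Units.coeHom ℂ).comp (MonoidHom.eval h)) fun heval => ?_
  obtain ⟨φ, hφ⟩ := CommGroup.exists_apply_ne_one_of_hasEnoughRootsOfUnity H ℂ hh
  exact hφ (Units.ext (DFunLike.congr_fun heval φ))

/-- The projection onto the weight space of `χ`. -/
def weightProj (χ : H →* ℂˣ) : V →ₗ[ℂ] V :=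
  letI := Fintype.ofFinite H
  (Nat.card H : ℂ)⁻¹ • ∑ h : H, (χ h⁻¹ : ℂ) • ρ h

theorem weightProj_apply [Fintype H] (χ : H →* ℂˣ) (v : V) :
    weightProj ρ χ v = (Nat.card H : ℂ)⁻¹ • ∑ h : H, (χ h⁻¹ : ℂ) • ρ h v := by
  rw [weightProj, LinearMap.smul_apply, LinearMap.sum_apply]
  simp only [LinearMap.smul_apply]
  congr!

theorem weightProj_rho (χ : H →* ℂˣ) (k : H) (v : V) :
    weightProj ρ χ (ρ k v) = (χ k : ℂ) • weightProj ρ χ v := by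
  have := Fintype.ofFinite H
  rw [weightProj_apply, weightProj_apply, smul_comm (χ k : ℂ), Finset.smul_sum (r := (χ k : ℂ)),
    ← Equiv.sum_comp (Equiv.mulRight k) fun h => (χ k : ℂ) • (χ h⁻¹ : ℂ) • ρ h v]
  congr 1
  refine Finset.sum_congr rfl fun h _ => ?_
  rw [Equiv.coe_mulRight, smul_smul, ← Units.val_mul, ← map_mul, map_mul ρ, Module.End.mul_apply,
    mul_inv_rev, mul_inv_cancel_left]

theorem weightProj_mem_weightSpace (χ : H →* ℂˣ) (v : V) :
    weightProj ρ χ v ∈ weightSpace ρ χ := by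
  have := Fintype.ofFinite H
  intro k
  rw [← weightProj_rho, weightProj_apply, weightProj_apply, map_smul, map_sum]
  congr 1
  refine Finset.sum_congr rfl fun h _ => ?_
  rw [map_smul, ← Module.End.mul_apply, ← Module.End.mul_apply, ← map_mul, ← map_mul, mul_comm]

theorem weightProj_mem {p : Submodule ℂ V} (hp : ∀ h, ∀ v ∈ p, ρ h v ∈ p) (χ : H →* ℂˣ) {v : V}
    (hv : v ∈ p) : weightProj ρ χ v ∈ p := by
  have := Fintype.ofFinite H
  rw [weightProj_apply]
  exact p.smul_mem _ (p.sum_mem fun h _ => p.smul_mem _ (hp h v hv))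

theorem weightProj_of_mem_weightSpace {v : V} (hv : v ∈ weightSpace ρ χ) :
    weightProj ρ χ v = v := by
  have := Fintype.ofFinite H
  have hterm : ∀ h : H, (χ h⁻¹ : ℂ) • ρ h v = v := fun h => by
    rw [hv h, smul_smul, ← Units.val_mul, ← map_mul, inv_mul_cancel, map_one, Units.val_one,
      one_smul]
  simp only [weightProj_apply, hterm, Finset.sum_const, Finset.card_univ]
  rw [← Nat.card_eq_fintype_card, ← Nat.cast_smul_eq_nsmul ℂ, inv_smul_smul₀ (by simp)]

theorem sum_weightProj [Fintype (H →* ℂˣ)] (v : V) :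
    ∑ χ : H →* ℂˣ, weightProj ρ χ v = v := by
  classical
  have := Fintype.ofFinite H
  have horth : ∀ h : H, ∑ χ : H →* ℂˣ, (χ h⁻¹ : ℂ) • ρ h v =
      if h = 1 then (Nat.card H : ℂ) • v else 0 := fun h => by
    rw [← Finset.sum_smul]
    split_ifs with hh
    · have hcard := CommGroup.card_monoidHom_of_hasEnoughRootsOfUnity H ℂ
      rw [Nat.card_eq_fintype_card, Nat.card_eq_fintype_card] at hcard
      simp [hh, hcard]
    · rw [sum_characters_apply_eq_zero (inv_ne_one.2 hh), zero_smul]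
  simp only [weightProj_apply]
  rw [← Finset.smul_sum, Finset.sum_comm, Finset.sum_congr rfl fun h _ => horth h,
    Finset.sum_ite_eq' Finset.univ (1 : H), if_pos (Finset.mem_univ _), inv_smul_smul₀ (by simp)]

theorem exists_mem_weightSpace_ne_zero {p : Submodule ℂ V} (hp : ∀ h, ∀ v ∈ p, ρ h v ∈ p)
    (hp0 : p ≠ ⊥) : ∃ χ : H →* ℂˣ, ∃ v ∈ p, v ∈ weightSpace ρ χ ∧ v ≠ 0 := by
  have := Fintype.ofFinite (H →* ℂˣ)
  obtain ⟨v, hv, hv0⟩ := p.exists_mem_ne_zero_of_ne_bot hp0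
  by_contra! h
  exact hv0 <| (sum_weightProj ρ v).symm.trans <| Finset.sum_eq_zero fun χ _ =>
    h χ _ (weightProj_mem ρ hp χ hv) (weightProj_mem_weightSpace ρ χ v)

variable {ρ} in
theorem exists_equivariant_apply_eq_one {v : V} (hv : v ∈ weightSpace ρ χ) (hv0 : v ≠ 0) :
    ∃ q : V →ₗ[ℂ] ℂ, (∀ h x, q (ρ h x) = (χ h : ℂ) * q x) ∧ q v = 1 := by
  obtain ⟨l, hl⟩ := Module.Projective.exists_dual_eq_one ℂ hv0
  refine ⟨l ∘ₗ weightProj ρ χ, fun h x => ?_, ?_⟩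
  · rw [LinearMap.comp_apply, weightProj_rho, map_smul, smul_eq_mul, LinearMap.comp_apply]
  · rw [LinearMap.comp_apply, weightProj_of_mem_weightSpace ρ hv, hl]

end WeightProj

section RepBasis

/-- The splitting of a vector space as a line and the kernel of a functional. -/
def equivProdKer {K V : Type*} [Field K] [AddCommGroup V] [Module K V] (q : V →ₗ[K] K) (v : V)
    (hqv : q v = 1) : V ≃ₗ[K] K × LinearMap.ker q :=
  LinearEquiv.ofLinearMap
    (q.prod ((LinearMap.id - q.smulRight v).codRestrict (LinearMap.ker q) fun x => by simp [hqv]))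
    ((LinearMap.toSpanSingleton K V v).coprod (LinearMap.ker q).subtype)
    (LinearMap.ext fun x => Prod.ext (by simp [hqv]) (Subtype.ext (by simp [hqv])))
    (by ext x; simp)

variable {H : Type u}

theorem mk_eq_charClass_add [Group H] {V : FinRep H} {χ : H →* ℂˣ} {v : V.carrier}
    (hv : v ∈ weightSpace V.ρ χ) {q : V.carrier →ₗ[ℂ] ℂ}
    (hq : ∀ h x, q (V.ρ h x) = (χ h : ℂ) * q x) (hqv : q v = 1) :
    ∃ W : FinRep H, Module.finrank ℂ W.carrier < Module.finrank ℂ V.carrier ∧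
      RepClass.mk V = charClass χ + RepClass.mk W := by
  let K : Subrepresentation V.ρ := ⟨LinearMap.ker q, fun h x hx => by
    rw [LinearMap.mem_ker, hq, LinearMap.mem_ker.1 hx, mul_zero]⟩
  refine ⟨⟨K.toSubmodule, K.toRepresentation⟩, ?_, ?_⟩
  · have := (equivProdKer q v hqv).finrank_eq
    rw [Module.finrank_prod, Module.finrank_self] at this
    change Module.finrank ℂ (LinearMap.ker q) < _
    omega
  · refine RepClass.sound (W := (charRep χ).sum ⟨K.toSubmodule, K.toRepresentation⟩)
      (equivProdKer q v hqv) fun g x => Prod.ext (hq g x) (Subtype.ext ?_)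
    change V.ρ g x - q (V.ρ g x) • v = V.ρ g (x - q x • v)
    rw [hq, map_sub, map_smul, hv g, smul_smul, mul_comm]

variable [CommGroup H] [Finite H]

theorem closure_range_charClass :
    AddSubmonoid.closure (Set.range (charClass (H := H))) = ⊤ := by
  refine closure_eq_top_of_exists_add (cls := RepClass.mk) Quotient.mk_surjective
    (fun V => Module.finrank ℂ V.carrier) fun V => ?_
  rcases subsingleton_or_nontrivial V.carrier with hV | hV
  · exact .inl <| RepClass.sound (W := ⟨PUnit, .trivial ℂ H PUnit⟩)
      (LinearEquiv.ofSubsingleton V.carrier PUnit.{1}) fun _ _ => rfl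
  · obtain ⟨χ, v, -, hv, hv0⟩ := exists_mem_weightSpace_ne_zero V.ρ (p := ⊤)
      (fun _ _ _ => Submodule.mem_top) top_ne_bot
    obtain ⟨q, hq, hqv⟩ := exists_equivariant_apply_eq_one hv hv0
    exact .inr ⟨charClass χ, ⟨χ, rfl⟩, mk_eq_charClass_add hv hq hqv⟩

variable (H) in
/-- The basis of the representation ring of a finite abelian group formed by its characters. -/
def repRingBasis : Module.Basis (H →* ℂˣ) ℤ (RepRing H) :=
  grothBasis weightMult_charClass_self (fun _ _ => weightMult_charClass_of_ne)
    closure_range_charClass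

theorem repRingBasis_apply (χ : H →* ℂˣ) :
    repRingBasis H χ = GrothendieckAddGroup.of (charClass χ) :=
  grothBasis_apply _ _ _ χ

variable (H) in
/-- The representation ring of a finite abelian group is the integral group ring of its dual. -/
def dualGroupRingEquivRepRing : MonoidAlgebra ℤ (H →* ℂˣ) ≃ₐ[ℤ] RepRing H :=
  let c : (H →* ℂˣ) →* RepRing H :=
    { toFun := fun χ => GrothendieckAddGroup.of (charClass χ)
      map_one' := congrArg _ charClass_one
      map_mul' := fun χ ψ => (congrArg _ (charClass_mul χ ψ)).trans
        (grothAct_of_of (S := RepClass H) (M := RepClass H) _ _).symm }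
  .ofBijective (MonoidAlgebra.lift ℤ (RepRing H) _ c) (by
    have hlift : (MonoidAlgebra.lift ℤ (RepRing H) _ c).toLinearMap =
        ((MonoidAlgebra.basis (H →* ℂˣ) ℤ).equiv (repRingBasis H) (.refl _)).toLinearMap :=
      (MonoidAlgebra.basis (H →* ℂˣ) ℤ).ext fun χ => by
        rw [LinearEquiv.coe_coe, Module.Basis.equiv_apply]
        simp [c, repRingBasis_apply]
    rw [← AlgHom.coe_toLinearMap, hlift]
    exact LinearEquiv.bijective _)

/-- Base change of a ring isomorphic to a monoid algebra. -/
def tensorEquivMonoidAlgebra {R S B M : Type*} [CommRing R] [CommRing S] [Algebra R S]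
    [CommRing B] [Algebra R B] [CommMonoid M] (e : MonoidAlgebra R M ≃ₐ[R] B) :
    B ⊗[R] S ≃ₐ[R] MonoidAlgebra S M :=
  (Algebra.TensorProduct.congr e.symm AlgEquiv.refl).trans <|
    (Algebra.TensorProduct.comm R (MonoidAlgebra R M) S).trans <|
      (MonoidAlgebra.scalarTensorEquiv R S).restrictScalars R

variable (H) in
theorem nonempty_repRing_rat_equiv : Nonempty (RepRing H ⊗[ℤ] ℚ ≃+* MonoidAlgebra ℚ H) := by
  obtain ⟨d⟩ := CommGroup.monoidHom_mulEquiv_of_hasEnoughRootsOfUnity H ℂ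
  exact ⟨(tensorEquivMonoidAlgebra (dualGroupRingEquivRepRing H)).toRingEquiv.trans <|
    MonoidAlgebra.mapDomainRingEquiv ℚ d⟩

end RepBasis

open SkewMonoidAlgebra

section ModuleTheory

theorem isSemisimpleRing_of_projective {R : Type*} [Ring R]
    (h : ∀ I : Ideal R, Module.Projective R (R ⧸ I)) : IsSemisimpleRing R := by
  refine (isSemisimpleModule_iff R R).2 ⟨fun I => ?_⟩
  have := h I
  obtain ⟨T, hT⟩ := Module.projective_lifting_property I.mkQ LinearMap.id I.mkQ_surjective
  have hmem : ∀ x, (LinearMap.id - T ∘ₗ I.mkQ : R →ₗ[R] R) x ∈ I := fun x => by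
    refine (Submodule.Quotient.mk_eq_zero I).1 ?_
    rw [← I.mkQ_apply, LinearMap.sub_apply, map_sub, sub_eq_zero]
    exact (LinearMap.congr_fun hT (I.mkQ x)).symm
  refine ⟨LinearMap.ker (LinearMap.codRestrict I _ hmem), LinearMap.isCompl_of_proj fun x => ?_⟩
  refine Subtype.ext ?_
  rw [LinearMap.codRestrict_apply, LinearMap.sub_apply, LinearMap.comp_apply, Submodule.mkQ_apply,
    (Submodule.Quotient.mk_eq_zero I).2 x.2, map_zero, sub_zero, LinearMap.id_apply]

theorem exists_linearMap_ne_zero_of_isSimpleRing {A : Type*} [Ring A] [IsSimpleRing A]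
    [IsArtinianRing A] (E F : Type*) [AddCommGroup E] [AddCommGroup F] [Module A E] [Module A F]
    [Nontrivial E] [Nontrivial F] : ∃ f : E →ₗ[A] F, f ≠ 0 := by
  obtain ⟨S, hS⟩ := IsSemisimpleModule.exists_simple_submodule A E
  obtain ⟨T, hT⟩ := IsSemisimpleModule.exists_simple_submodule A F
  let S' := S.equivMapOfInjective (LinearMap.inl A E F) LinearMap.inl_injective
  let T' := T.equivMapOfInjective (LinearMap.inr A E F) LinearMap.inr_injective
  have := IsSimpleModule.congr S'.symm
  have := IsSimpleModule.congr T'.symm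
  obtain ⟨d⟩ := IsSimpleRing.isIsotypic A (E × F) (T.map (LinearMap.inr A E F))
    (S.map (LinearMap.inl A E F))
  let j : S →ₗ[A] F := T.subtype ∘ₗ (S'.trans (d.trans T'.symm)).toLinearMap
  obtain ⟨f, hf⟩ := IsSemisimpleModule.extension_property S.subtype S.subtype_injective j
  have hj : Function.Injective j := T.subtype_injective.comp (LinearEquiv.injective _)
  have := IsSimpleModule.nontrivial A S
  obtain ⟨s, hs⟩ := exists_ne (0 : S)
  refine ⟨f, ?_⟩
  rintro rfl
  exact hs (hj (by rw [← hf]; rfl))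

variable {R S M N P : Type*} [Ring R] [Ring S] [AddCommGroup M] [AddCommGroup N] [AddCommGroup P]
  [Module R M] [Module R N] [Module S P] {σ : R →+* S}

theorem bijective_of_semilinear_of_ne_zero [RingHomSurjective σ] [IsSimpleModule R M]
    [IsSimpleModule S P] {f : M →ₛₗ[σ] P} (h0 : f ≠ 0) : Function.Bijective f := by
  refine ⟨LinearMap.ker_eq_bot.1 ?_, LinearMap.range_eq_top.1 ?_⟩
  · exact (eq_bot_or_eq_top _).resolve_right fun h => h0 (LinearMap.ker_eq_top.1 h)
  · exact (eq_bot_or_eq_top _).resolve_left fun h => h0 (LinearMap.range_eq_bot.1 h)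

theorem nonempty_linearEquiv_of_semilinear {f : M →ₛₗ[σ] P} {g : N →ₛₗ[σ] P}
    (hf : Function.Bijective f) (hg : Function.Bijective g) : Nonempty (M ≃ₗ[R] N) := by
  let e : M ≃+ N := (AddEquiv.ofBijective f hf).trans (AddEquiv.ofBijective g hg).symm
  have hge : ∀ x, g (e x) = f x := fun x =>
    (AddEquiv.ofBijective g hg).apply_symm_apply (f x)
  exact ⟨e.toLinearEquiv fun c x => hg.1 (by rw [hge, map_smulₛₗ, map_smulₛₗ, hge])⟩

end ModuleTheory

/-- The isomorphism class of a finitely generated projective module. -/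
def ProjClass.mk {R : Type u} [Ring R] (E : FGProj R) : ProjClass R := Quotient.mk _ E

theorem ProjClass.mk_eq_mk {R : Type u} [Ring R] {E F : FGProj R} :
    ProjClass.mk E = ProjClass.mk F ↔ Nonempty (E.carrier ≃ₗ[R] F.carrier) :=
  Quotient.eq (r := FGProj.setoid R)

theorem ProjClass.mk_eq_zero_of_subsingleton {R : Type u} [Ring R] {P : FGProj R}
    [Subsingleton P.carrier] : ProjClass.mk P = 0 :=
  have : Subsingleton (FGProj.zero (R := R)).carrier := inferInstanceAs (Subsingleton PUnit)
  ProjClass.mk_eq_mk.2 ⟨.ofSubsingleton P.carrier (FGProj.zero (R := R)).carrier⟩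

section Crossed

variable {G : Type u} [Group G] {A : Type v} [Ring A] [Algebra ℂ A] [MulSemiringAction G A]
  [SMulCommClass G ℂ A]

theorem crossed_isSemisimpleRing [Finite G] [IsSemisimpleRing A] :
    IsSemisimpleRing (SkewMonoidAlgebra A G) :=
  isSemisimpleRing_of_projective fun _ => crossed_projective _

variable (A) in
/-- The dual action of characters on the crossed product: `χ` acts by `a g ↦ χ(g) a g`. -/
def dualAction (χ : G →* ℂˣ) : SkewMonoidAlgebra A G →+* SkewMonoidAlgebra A G :=
  liftNCRingHom singleOneRingHom
    { toFun := fun g => (χ g : ℂ) • of A G g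
      map_one' := by simp
      map_mul' := fun g h => by
        rw [map_mul, map_mul, Units.val_mul, smul_mul_smul_comm] }
    fun {a g} => by simp [singleOneRingHom, single_mul_single]

theorem dualAction_single (χ : G →* ℂˣ) (g : G) (a : A) :
    dualAction A χ (single g a) = (χ g : ℂ) • single g a := by
  simp [dualAction, liftNCRingHom, singleOneRingHom, single_mul_single]

instance dualAction_surjective (χ : G →* ℂˣ) :
    RingHomSurjective (dualAction A χ) := by
  refine ⟨fun b => ?_⟩
  induction b using SkewMonoidAlgebra.induction_on with
  | zero => exact ⟨0, map_zero _⟩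
  | add b c hb hc =>
    obtain ⟨b, rfl⟩ := hb
    obtain ⟨c, rfl⟩ := hc
    exact ⟨b + c, map_add _ _ _⟩
  | single g a =>
    refine ⟨single g ((χ g)⁻¹ • a), ?_⟩
    rw [dualAction_single, smul_single, ← Units.smul_def, smul_inv_smul]

/-- An additive map which is `dualAction χ`-semilinear on the elements `a g`. -/
def semilinearOfSingle {χ : G →* ℂˣ} {M N : Type*} [AddCommGroup M] [AddCommGroup N]
    [Module (SkewMonoidAlgebra A G) M] [Module (SkewMonoidAlgebra A G) N] (f : M →+ N)
    (hf : ∀ (g : G) (a : A) x, f ((single g a : SkewMonoidAlgebra A G) • x) =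
      ((χ g : ℂ) • single g a : SkewMonoidAlgebra A G) • f x) :
    M →ₛₗ[dualAction A χ] N where
  __ := f
  map_smul' b x := by
    change f (b • x) = dualAction A χ b • f x
    induction b using SkewMonoidAlgebra.induction_on with
    | zero => simp
    | add b c hb hc => rw [add_smul, map_add, hb, hc, map_add, add_smul]
    | single g a => rw [hf, dualAction_single]

variable [Finite G] [Module.Finite ℂ A] [IsSemisimpleRing A] {χ : G →* ℂˣ}
  {E F : FGProj (SkewMonoidAlgebra A G)}

variable (E) in
theorem exists_bijective_twist (χ : G →* ℂˣ) :
    ∃ f : (twist (charRep χ) E).carrier →ₛₗ[dualAction A χ] E.carrier, Function.Bijective f := by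
  let l : (twist (charRep χ) E).carrier →+ E.carrier :=
    (TensorProduct.lid ℂ E.carrier).toAddMonoidHom
  refine ⟨semilinearOfSingle l fun g a x => ?_, (TensorProduct.lid ℂ E.carrier).bijective⟩
  obtain ⟨y, rfl⟩ := (TensorProduct.lid ℂ E.carrier).symm.surjective x
  refine (congrArg l (twist_smul_tmul (charRep χ) E g a (1 : ℂ) y)).trans ?_
  change ((χ g : ℂ) * 1) • (single g a : SkewMonoidAlgebra A G) • y =
    ((χ g : ℂ) • single g a : SkewMonoidAlgebra A G) • ((1 : ℂ) • y)
  rw [mul_one, one_smul, smul_assoc]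

theorem charClass_smul_eq_iff : charClass χ • ProjClass.mk E = ProjClass.mk F ↔
    ∃ f : F.carrier →ₛₗ[dualAction A χ] E.carrier, Function.Bijective f := by
  obtain ⟨t, ht⟩ := exists_bijective_twist E χ
  change ProjClass.mk (twist (charRep χ) E) = _ ↔ _
  rw [ProjClass.mk_eq_mk]
  constructor
  · rintro ⟨e⟩
    exact ⟨t.comp e.symm.toLinearMap, ht.comp e.symm.bijective⟩
  · rintro ⟨f, hf⟩
    exact nonempty_linearEquiv_of_semilinear ht hf

theorem isSimpleModule_twist (χ : G →* ℂˣ) (E : FGProj (SkewMonoidAlgebra A G))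
    [IsSimpleModule (SkewMonoidAlgebra A G) E.carrier] :
    IsSimpleModule (SkewMonoidAlgebra A G) (twist (charRep χ) E).carrier := by
  obtain ⟨f, hf⟩ := exists_bijective_twist E χ
  exact (f.isSimpleModule_iff_of_bijective hf).2 ‹_›

end Crossed

section Transitivity

variable {G : Type u} [Group G] {A : Type v} [Ring A] [Algebra ℂ A] [MulSemiringAction G A]
  [SMulCommClass G ℂ A] {χ : G →* ℂˣ}

/-- A module over the crossed product as a representation of the group. -/
def groupRep (E : FGProj (SkewMonoidAlgebra A G)) : Representation ℂ G E.carrier :=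
  (Algebra.lsmul ℂ ℂ E.carrier : SkewMonoidAlgebra A G →ₐ[ℂ] _).toMonoidHom.comp (of A G)

/-- The maps of modules over the crossed product that are linear over the coefficient algebra. -/
def coeffHom (E F : FGProj (SkewMonoidAlgebra A G)) : Submodule ℂ (E.carrier →ₗ[ℂ] F.carrier) where
  carrier := {f | ∀ (a : A) x, f ((single 1 a : SkewMonoidAlgebra A G) • x) =
    (single 1 a : SkewMonoidAlgebra A G) • f x}
  zero_mem' a x := by simp
  add_mem' hf hg a x := by rw [LinearMap.add_apply, hf, hg, LinearMap.add_apply, smul_add]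
  smul_mem' c f hf a x := by rw [LinearMap.smul_apply, hf, LinearMap.smul_apply, smul_comm]

variable {E F : FGProj (SkewMonoidAlgebra A G)}

theorem linHom_mem_coeffHom (g : G) {f : E.carrier →ₗ[ℂ] F.carrier} (hf : f ∈ coeffHom E F) :
    (groupRep E).linHom (groupRep F) g f ∈ coeffHom E F := by
  intro a x
  change (single g 1 : SkewMonoidAlgebra A G) • f ((single g⁻¹ 1 : SkewMonoidAlgebra A G) •
      (single 1 a : SkewMonoidAlgebra A G) • x) = (single 1 a : SkewMonoidAlgebra A G) •
        (single g 1 : SkewMonoidAlgebra A G) • f ((single g⁻¹ 1 : SkewMonoidAlgebra A G) • x)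
  have h_inv : (single g⁻¹ 1 : SkewMonoidAlgebra A G) * single 1 a =
    single 1 (g⁻¹ • a) * single g⁻¹ 1 := by simp [single_mul_single]
  have h_mul : (single g 1 : SkewMonoidAlgebra A G) * single 1 (g⁻¹ • a) =
    single 1 a * single g 1 := by simp [single_mul_single]
  rw [smul_smul, h_inv, mul_smul, hf, smul_smul, h_mul, mul_smul]

theorem coeffHom_ne_bot [Module.Finite ℂ A] [IsSimpleRing A] [Nontrivial E.carrier]
    [Nontrivial F.carrier] : coeffHom E F ≠ ⊥ := by
  have := IsArtinianRing.of_finite ℂ A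
  let (E : FGProj (SkewMonoidAlgebra A G)) : Module A E.carrier :=
    Module.compHom E.carrier (singleOneRingHom : A →+* SkewMonoidAlgebra A G)
  have smul_eq (E : FGProj (SkewMonoidAlgebra A G)) (a : A) (x : E.carrier) :
    a • x = (single 1 a : SkewMonoidAlgebra A G) • x := rfl
  have (E : FGProj (SkewMonoidAlgebra A G)) : IsScalarTower ℂ A E.carrier := ⟨fun c a x => by
    rw [smul_eq, smul_eq, ← smul_single, smul_assoc]⟩
  obtain ⟨f, hf⟩ := exists_linearMap_ne_zero_of_isSimpleRing (A := A) E.carrier F.carrier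
  intro hbot
  have hmem : f.restrictScalars ℂ ∈ coeffHom E F := f.map_smul
  rw [hbot, Submodule.mem_bot] at hmem
  exact hf (LinearMap.ext fun x => LinearMap.congr_fun hmem x)

theorem apply_single_smul_of_mem_weightSpace {f : E.carrier →ₗ[ℂ] F.carrier}
    (hf : f ∈ coeffHom E F) (hχ : f ∈ weightSpace ((groupRep E).linHom (groupRep F)) χ)
    (g : G) (a : A) (x : E.carrier) : f ((single g a : SkewMonoidAlgebra A G) • x) =
      (((χ⁻¹ : G →* ℂˣ) g : ℂ) • single g a : SkewMonoidAlgebra A G) • f x := by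
  have h_inv : (single g⁻¹ 1 : SkewMonoidAlgebra A G) * single g a = single 1 (g⁻¹ • a) := by
    simp [single_mul_single]
  have h_mul : (single g 1 : SkewMonoidAlgebra A G) * single 1 (g⁻¹ • a) = single g a := by
    simp [single_mul_single]
  have hg : (single g 1 : SkewMonoidAlgebra A G) •
      f ((single g⁻¹ 1 : SkewMonoidAlgebra A G) • (single g a : SkewMonoidAlgebra A G) • x) =
        (χ g : ℂ) • f ((single g a : SkewMonoidAlgebra A G) • x) :=
    LinearMap.congr_fun (hχ g) _
  rw [smul_smul, h_inv, hf, smul_smul, h_mul] at hg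
  rw [smul_assoc, hg, smul_smul, MonoidHom.inv_apply, Units.inv_mul, one_smul]

end Transitivity

theorem exists_charClass_smul_eq {G : Type u} [CommGroup G] [Finite G] {A : Type v} [Ring A]
    [Algebra ℂ A] [MulSemiringAction G A] [SMulCommClass G ℂ A] [Module.Finite ℂ A]
    [IsSemisimpleRing A] [IsSimpleRing A] (E F : FGProj (SkewMonoidAlgebra A G))
    [IsSimpleModule (SkewMonoidAlgebra A G) E.carrier]
    [IsSimpleModule (SkewMonoidAlgebra A G) F.carrier] :
    ∃ χ : G →* ℂˣ, charClass χ • ProjClass.mk E = ProjClass.mk F := by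
  have := IsSimpleModule.nontrivial (SkewMonoidAlgebra A G) E.carrier
  have := IsSimpleModule.nontrivial (SkewMonoidAlgebra A G) F.carrier
  obtain ⟨χ, f, hf, hχ, hf0⟩ := exists_mem_weightSpace_ne_zero
    ((groupRep F).linHom (groupRep E)) (fun g _ => linHom_mem_coeffHom g) coeffHom_ne_bot
  let s : F.carrier →ₛₗ[dualAction A χ⁻¹] E.carrier :=
    semilinearOfSingle f.toAddMonoidHom (apply_single_smul_of_mem_weightSpace hf hχ)
  have hs : s ≠ 0 := fun h => hf0 (LinearMap.ext fun x => LinearMap.congr_fun h x)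
  exact ⟨χ⁻¹, charClass_smul_eq_iff.2 ⟨s, bijective_of_semilinear_of_ne_zero hs⟩⟩

section Inner

variable {G : Type u} [Group G] {A : Type v} [Ring A] [MulSemiringAction G A]

/-- The unit `u` implements `g`: the element `g` acts as conjugation by `u`. The central extension
consists of such pairs `(g, u)` with `u` of determinant one. -/
def Implements (g : G) (u : Aˣ) : Prop := ∀ a : A, g • a = u * a * ↑u⁻¹

theorem implements_one : Implements (1 : G) (1 : Aˣ) := fun a => by simp

theorem Implements.mul {g h : G} {u w : Aˣ} (hu : Implements g u) (hw : Implements h w) :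
    Implements (g * h) (u * w) := fun a => by
  rw [mul_smul, hw, hu, Units.val_mul, mul_inv_rev, Units.val_mul]
  simp only [mul_assoc]

theorem Implements.inv {g : G} {u : Aˣ} (hu : Implements g u) : Implements g⁻¹ u⁻¹ := fun a => by
  rw [inv_smul_eq_iff, hu, inv_inv, ← mul_assoc, ← mul_assoc, Units.mul_inv, one_mul,
    Units.mul_inv_cancel_right]

theorem Implements.smul_mul {g : G} {u : Aˣ} (hu : Implements g u) (a : A) :
    g • a * u = u * a := by
  rw [hu, Units.inv_mul_cancel_right]

theorem Implements.smul_eq_self_iff {g : G} {u : Aˣ} (hu : Implements g u) (a : A) :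
    g • a = a ↔ Commute (u : A) a := by
  rw [hu, Units.mul_inv_eq_iff_eq_mul, commute_iff_eq]

/-- The unit `u⁻¹ g` of the crossed product, for a unit `u` of the coefficient ring. It centralizes
the coefficients if `u` implements `g`. -/
def twistUnit (g : G) (u : Aˣ) : (SkewMonoidAlgebra A G)ˣ where
  val := single g (↑u⁻¹ : A)
  inv := single g⁻¹ (g⁻¹ • (u : A))
  val_inv := by
    rw [single_mul_single, smul_inv_smul, Units.inv_mul, mul_inv_cancel, single_one_one]
  inv_val := by
    rw [single_mul_single, ← smul_mul', Units.mul_inv, smul_one, inv_mul_cancel, single_one_one]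

theorem val_twistUnit (g : G) (u : Aˣ) :
    (twistUnit g u : SkewMonoidAlgebra A G) = single g (↑u⁻¹ : A) := rfl

variable [Algebra ℂ A]

theorem Implements.smul {g : G} {u : Aˣ} (hu : Implements g u) (c : ℂˣ) :
    Implements g (c • u) := fun a => by
  rw [hu, Units.smul_inv, Units.val_smul, Units.val_smul, smul_mul_assoc, smul_mul_smul_comm,
    mul_inv_cancel, one_smul]

theorem smul_val_inv_eq_inv_smul {g : G} {u : Aˣ} {c : ℂˣ} (h : g • (u : A) = c • (u : A)) :
    g • (↑u⁻¹ : A) = c⁻¹ • (↑u⁻¹ : A) := by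
  refine (left_inv_eq_right_inv (a := g • (u : A)) ?_ ?_).symm
  · rw [h, smul_mul_smul_comm, inv_mul_cancel, one_smul, Units.inv_mul]
  · rw [← smul_mul', Units.mul_inv, smul_one]

variable [SMulCommClass G ℂ A]

variable (G A) in
/-- The characters through which `G` acts on the units implementing its elements: the image of `G`
in its dual under the commutator pairing of the central extension. -/
def innerCharacters : Subgroup (G →* ℂˣ) where
  carrier := {χ | ∃ (g : G) (u : Aˣ), Implements g u ∧ ∀ h : G, h • (u : A) = χ h • (u : A)}
  one_mem' := ⟨1, 1, implements_one, fun h => by simp⟩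
  mul_mem' := by
    rintro χ ψ ⟨g, u, hu, hχ⟩ ⟨h, w, hw, hψ⟩
    refine ⟨g * h, u * w, hu.mul hw, fun k => ?_⟩
    rw [Units.val_mul, smul_mul', hχ, hψ, smul_mul_smul_comm, MonoidHom.mul_apply]
  inv_mem' := by
    rintro χ ⟨g, u, hu, hχ⟩
    exact ⟨g⁻¹, u⁻¹, hu.inv, fun k => smul_val_inv_eq_inv_smul (hχ k)⟩

end Inner

theorem dualAction_one {G : Type u} [Group G] {A : Type v} [Ring A] [Algebra ℂ A]
    [MulSemiringAction G A] [SMulCommClass G ℂ A] (b : SkewMonoidAlgebra A G) :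
    dualAction A 1 b = b := by
  induction b using SkewMonoidAlgebra.induction_on with
  | zero => rw [map_zero]
  | add b c hb hc => rw [map_add, hb, hc]
  | single g a => rw [dualAction_single, MonoidHom.one_apply, Units.val_one, one_smul]

theorem dualAction_algebraMap {G : Type u} [Group G] {A : Type v} [Ring A] [Algebra ℂ A]
    [MulSemiringAction G A] [SMulCommClass G ℂ A] (χ : G →* ℂˣ) (c : ℂ) :
    dualAction A χ (algebraMap ℂ _ c) = algebraMap ℂ _ c := by
  rw [Algebra.algebraMap_eq_smul_one, ← single_one_one, smul_single, dualAction_single, map_one,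
    Units.val_one, one_smul]

section Stabilizer

variable {G : Type u} [CommGroup G] {A : Type v} [Ring A] [Algebra ℂ A] [MulSemiringAction G A]
  [SMulCommClass G ℂ A] {χ : G →* ℂˣ}

theorem Implements.exists_character [Algebra.IsCentral ℂ A] [Nontrivial A] {g : G} {u : Aˣ}
    (hu : Implements g u) : ∃ χ : G →* ℂˣ, ∀ h : G, h • (u : A) = χ h • (u : A) := by
  have h_comm (h : G) (a : A) : a * (↑u⁻¹ * h • (u : A)) = ↑u⁻¹ * h • (u : A) * a := by
    have h_smul : h • (u : A) * a = g • a * h • (u : A) := by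
      calc h • (u : A) * a = h • ((u : A) * h⁻¹ • a) := by rw [smul_mul', smul_inv_smul]
        _ = h • (g • h⁻¹ • a * (u : A)) := by rw [hu.smul_mul]
        _ = g • a * h • (u : A) := by rw [smul_mul', ← smul_comm g h, smul_inv_smul]
    rw [mul_assoc, h_smul, hu, ← mul_assoc, mul_assoc (u : A), mul_assoc (u : A),
      Units.inv_mul_cancel_left]
  have h_scalar (h : G) : ∃ c : ℂ, h • (u : A) = c • (u : A) := by
    obtain ⟨c, hc⟩ := (Algebra.IsCentral.mem_center_iff ℂ).1
      (Subalgebra.mem_center_iff.2 (h_comm h))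
    exact ⟨c, by rw [(Units.inv_mul_eq_iff_eq_mul u).1 hc, ← Algebra.commutes, Algebra.smul_def]⟩
  choose c hc using h_scalar
  have h_inj := smul_left_injective ℂ u.ne_zero
  let κ : G →* ℂ :=
    { toFun := c
      map_one' := h_inj (by simp only [← hc, one_smul])
      map_mul' := fun h k => h_inj (by
        simp only [← hc, mul_smul]
        rw [hc k, smul_comm h, hc h, smul_comm]) }
  exact ⟨κ.toHomUnits, hc⟩

theorem twistUnit_mul {g : G} {u : Aˣ} (hu : Implements g u)
    (hχ : ∀ h : G, h • (u : A) = χ h • (u : A)) (b : SkewMonoidAlgebra A G) :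
    twistUnit g u * b = dualAction A χ b * twistUnit g u := by
  induction b using SkewMonoidAlgebra.induction_on with
  | zero => rw [map_zero, mul_zero, zero_mul]
  | add b c hb hc => rw [map_add, mul_add, add_mul, hb, hc]
  | single h a =>
    rw [val_twistUnit, dualAction_single, smul_mul_assoc, single_mul_single, single_mul_single,
      smul_val_inv_eq_inv_smul (hχ h), smul_single, mul_comm h g, hu]
    congr 1
    rw [← mul_assoc, ← mul_assoc, Units.inv_mul, one_mul, mul_smul_comm, ← Units.smul_def,
      smul_inv_smul]

variable [Finite G] [Module.Finite ℂ A]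

theorem exists_twistUnit_smul_eq {g : G} {u : Aˣ} (hu : Implements g u)
    (h_fix : ∀ h : G, h • (u : A) = u) (E : FGProj (SkewMonoidAlgebra A G))
    [IsSimpleModule (SkewMonoidAlgebra A G) E.carrier] :
    ∃ c : ℂ, c ≠ 0 ∧ ∀ x : E.carrier, (twistUnit g u : SkewMonoidAlgebra A G) • x = c • x := by
  have h_central (b : SkewMonoidAlgebra A G) :
      (twistUnit g u : SkewMonoidAlgebra A G) * b = b * twistUnit g u := by
    rw [twistUnit_mul (χ := 1) hu fun h => ?_, dualAction_one]
    rw [h_fix, MonoidHom.one_apply, one_smul]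
  have : Module.Finite ℂ E.carrier := Module.Finite.trans (SkewMonoidAlgebra A G) E.carrier
  let φ : Module.End (SkewMonoidAlgebra A G) E.carrier :=
    { toFun := fun x => (twistUnit g u : SkewMonoidAlgebra A G) • x
      map_add' := smul_add _
      map_smul' := fun b x => by rw [smul_smul, h_central, mul_smul, RingHom.id_apply] }
  obtain ⟨c, hc⟩ := (IsSimpleModule.algebraMap_end_bijective_of_isAlgClosed
    (A := SkewMonoidAlgebra A G) (V := E.carrier) ℂ).2 φ
  have hc (x : E.carrier) : (twistUnit g u : SkewMonoidAlgebra A G) • x = c • x :=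
    (LinearMap.congr_fun hc x).symm
  refine ⟨c, ?_, hc⟩
  rintro rfl
  have := IsSimpleModule.nontrivial (SkewMonoidAlgebra A G) E.carrier
  obtain ⟨x, hx⟩ := exists_ne (0 : E.carrier)
  exact hx ((smul_eq_zero_iff_eq (twistUnit g u)).1 ((hc x).trans (zero_smul ℂ x)))

variable [IsSemisimpleRing A]

theorem charClass_smul_eq_self (hχ : χ ∈ innerCharacters G A)
    (E : FGProj (SkewMonoidAlgebra A G)) : charClass χ • ProjClass.mk E = ProjClass.mk E := by
  obtain ⟨g, u, hu, hχ⟩ := hχ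
  let f : E.carrier →ₛₗ[dualAction A χ] E.carrier :=
    { DistribSMul.toAddMonoidHom E.carrier (twistUnit g u : SkewMonoidAlgebra A G) with
      map_smul' := fun b x => by
        change (twistUnit g u : SkewMonoidAlgebra A G) • b • x =
          dualAction A χ b • (twistUnit g u : SkewMonoidAlgebra A G) • x
        rw [smul_smul, twistUnit_mul hu hχ, mul_smul] }
  exact charClass_smul_eq_iff.2 ⟨f, MulAction.bijective (twistUnit g u)⟩

theorem eq_one_of_charClass_smul_eq_self {g : G} {u : Aˣ} (hu : Implements g u)
    (h_fix : ∀ h : G, h • (u : A) = u) (E : FGProj (SkewMonoidAlgebra A G))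
    [IsSimpleModule (SkewMonoidAlgebra A G) E.carrier]
    (hE : charClass χ • ProjClass.mk E = ProjClass.mk E) : χ g = 1 := by
  obtain ⟨c, hc0, hc⟩ := exists_twistUnit_smul_eq hu h_fix E
  obtain ⟨f, hf⟩ := charClass_smul_eq_iff.1 hE
  have := IsSimpleModule.nontrivial (SkewMonoidAlgebra A G) E.carrier
  obtain ⟨y, hy⟩ := exists_ne (0 : E.carrier)
  obtain ⟨x, rfl⟩ := hf.2 y
  have h_smul : f (c • x) = c • f x := by
    rw [← algebraMap_smul (SkewMonoidAlgebra A G) c x, f.map_smulₛₗ, dualAction_algebraMap,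
      algebraMap_smul]
  have h_twist : c • f x = (χ g : ℂ) • c • f x := by
    calc c • f x = f ((twistUnit g u : SkewMonoidAlgebra A G) • x) := by rw [hc, h_smul]
      _ = ((χ g : ℂ) • twistUnit g u : SkewMonoidAlgebra A G) • f x := by
        rw [f.map_smulₛₗ, val_twistUnit, dualAction_single]
      _ = (χ g : ℂ) • c • f x := by rw [smul_assoc, hc]
  have h_zero : ((χ g : ℂ) - 1) • c • f x = 0 := by rw [sub_smul, one_smul, ← h_twist, sub_self]
  exact Units.ext (sub_eq_zero.1 ((smul_eq_zero.1 h_zero).resolve_right (smul_ne_zero hc0 hy)))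

end Stabilizer

section MatrixAction

theorem exists_conj_of_algEquiv {ι K : Type*} [Fintype ι] [DecidableEq ι] [Field K]
    (α : Matrix ι ι K ≃ₐ[K] Matrix ι ι K) :
    ∃ u : GL ι K, ∀ a, α a = u * a * (↑u⁻¹ : Matrix ι ι K) := by
  let τ : Matrix ι ι K ≃ₐ[K] Module.End K (ι → K) := Matrix.toLinAlgEquiv'
  obtain ⟨T, hT⟩ := ((τ.symm.trans α).trans τ).eq_linearEquivConjAlgEquiv
  let t := LinearMap.GeneralLinearGroup.ofLinearEquiv T
  refine ⟨Matrix.GeneralLinearGroup.toLin.symm t, fun a => τ.injective ?_⟩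
  have h_conj : τ (α (τ.symm (τ a))) = t * τ a * ↑t⁻¹ := DFunLike.congr_fun hT (τ a)
  rw [AlgEquiv.symm_apply_apply] at h_conj
  rw [h_conj, map_mul, map_mul, ← map_inv]
  congr
  · exact (τ.apply_symm_apply _).symm
  · exact (τ.apply_symm_apply _).symm

theorem exists_toGL_eq_smul {ι K : Type*} [Fintype ι] [DecidableEq ι] [Nonempty ι] [Field K]
    [IsAlgClosed K] (u : GL ι K) :
    ∃ (c : Kˣ) (s : Matrix.SpecialLinearGroup ι K), (s : GL ι K) = c • u := by
  obtain ⟨c, hc⟩ := IsAlgClosed.exists_pow_nat_eq (u.det : K) (Fintype.card_pos (α := ι))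
  have hc0 : c ≠ 0 := by
    rintro rfl
    rw [zero_pow Fintype.card_ne_zero] at hc
    exact u.det.ne_zero hc.symm
  refine ⟨(Units.mk0 c hc0)⁻¹, ⟨c⁻¹ • u, ?_⟩, Units.ext rfl⟩
  rw [Matrix.det_smul, ← Matrix.GeneralLinearGroup.val_det_apply, ← hc, inv_pow,
    inv_mul_cancel₀ (pow_ne_zero _ hc0)]

variable {G : Type u} [Group G] {n : ℕ} [MulSemiringAction G (Matrix (Fin n) (Fin n) ℂ)]

theorem mem_centralExtension_iff {g : G} {s : Matrix.SpecialLinearGroup (Fin n) ℂ} :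
    (g, s) ∈ centralExtension G n ↔ Implements g (s : GL (Fin n) ℂ) := Iff.rfl

variable [SMulCommClass G ℂ (Matrix (Fin n) (Fin n) ℂ)]

theorem exists_implements (g : G) : ∃ u : GL (Fin n) ℂ, Implements g u :=
  exists_conj_of_algEquiv (MulSemiringAction.toAlgEquiv ℂ (Matrix (Fin n) (Fin n) ℂ) g)

variable [NeZero n]

theorem exists_mem_centralExtension (g : G) :
    ∃ s : Matrix.SpecialLinearGroup (Fin n) ℂ, (g, s) ∈ centralExtension G n := by
  obtain ⟨u, hu⟩ := exists_implements (n := n) g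
  obtain ⟨c, s, hs⟩ := exists_toGL_eq_smul u
  exact ⟨s, mem_centralExtension_iff.2 (hs ▸ hu.smul c)⟩

end MatrixAction

section MatrixStabilizer

variable {G : Type u} [CommGroup G] {n : ℕ} [MulSemiringAction G (Matrix (Fin n) (Fin n) ℂ)]
  [SMulCommClass G ℂ (Matrix (Fin n) (Fin n) ℂ)] [NeZero n] {χ : G →* ℂˣ}

theorem mem_centerImage_iff {g : G} : g ∈ centerImage G n ↔ ∃ u : GL (Fin n) ℂ, Implements g u ∧
    ∀ h : G, h • (u : Matrix (Fin n) (Fin n) ℂ) = u := by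
  constructor
  · rintro ⟨⟨⟨g, s⟩, hs⟩, hc, rfl⟩
    refine ⟨s, mem_centralExtension_iff.1 hs, fun h => ?_⟩
    obtain ⟨w, hw⟩ := exists_mem_centralExtension (n := n) h
    refine ((mem_centralExtension_iff.1 hw).smul_eq_self_iff _).2 ?_
    exact congrArg (fun p : centralExtension G n => (p.1.2 : Matrix (Fin n) (Fin n) ℂ))
      (Subgroup.mem_center_iff.1 hc ⟨(h, w), hw⟩)
  · rintro ⟨u, hu, h_fix⟩
    obtain ⟨c, s, hs⟩ := exists_toGL_eq_smul u
    refine ⟨⟨(g, s), mem_centralExtension_iff.2 (hs ▸ hu.smul c)⟩, ?_, rfl⟩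
    refine Subgroup.mem_center_iff.2 ?_
    rintro ⟨⟨h, w⟩, hw⟩
    have h_comm : Commute (w : Matrix (Fin n) (Fin n) ℂ) ((s : GL (Fin n) ℂ) : Matrix _ _ ℂ) := by
      rw [hs]
      exact (((mem_centralExtension_iff.1 hw).smul_eq_self_iff _).1 (h_fix h)).smul_right c
    exact Subtype.ext (Prod.ext (mul_comm h g) (Subtype.ext h_comm))

theorem mem_centerImage_of_forall_innerCharacters {g : G}
    (hg : ∀ χ ∈ innerCharacters G (Matrix (Fin n) (Fin n) ℂ), χ g = 1) : g ∈ centerImage G n := by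
  obtain ⟨w, hw⟩ := exists_implements (n := n) g
  refine mem_centerImage_iff.2 ⟨w, hw, fun h => ?_⟩
  obtain ⟨u, hu⟩ := exists_implements (n := n) h
  obtain ⟨χ, hχ⟩ := hu.exists_character
  have h_fix : g • (u : Matrix (Fin n) (Fin n) ℂ) = u := by
    rw [hχ, hg χ ⟨h, u, hu, hχ⟩, one_smul]
  exact (hu.smul_eq_self_iff _).2 ((hw.smul_eq_self_iff _).1 h_fix).symm

variable [Finite G]

theorem mem_innerCharacters_of_forall_centerImage (hχ : ∀ g ∈ centerImage G n, χ g = 1) :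
    χ ∈ innerCharacters G (Matrix (Fin n) (Fin n) ℂ) := by
  let Θ := CommGroup.subgroupOrderIsoSubgroupMonoidHom G ℂ
  let Φ := innerCharacters G (Matrix (Fin n) (Fin n) ℂ)
  have h_dual : (Θ (Θ.symm (OrderDual.toDual Φ))).ofDual = Φ :=
    congrArg OrderDual.ofDual (Θ.apply_symm_apply _)
  change χ ∈ Φ
  rw [← h_dual, CommGroup.mem_subgroupOrderIsoSubgroupMonoidHom_iff]
  intro g hg
  rw [CommGroup.mem_subgroupOrderIsoSubgroupMonoidHom_symm_iff] at hg
  exact hχ g (mem_centerImage_of_forall_innerCharacters hg)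

theorem charClass_smul_eq_self_iff (E : FGProj (CrossedProduct G n))
    [IsSimpleModule (CrossedProduct G n) E.carrier] :
    charClass χ • ProjClass.mk E = ProjClass.mk E ↔ ∀ g ∈ centerImage G n, χ g = 1 := by
  refine ⟨fun hE g hg => ?_, fun hχ => ?_⟩
  · obtain ⟨u, hu, h_fix⟩ := mem_centerImage_iff.1 hg
    exact eq_one_of_charClass_smul_eq_self hu h_fix E hE
  · exact charClass_smul_eq_self (mem_innerCharacters_of_forall_centerImage hχ) E

end MatrixStabilizer

section SemisimpleRing

variable (R : Type u) [Ring R] [IsSemisimpleRing R]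

theorem exists_simple_fgProj [Nontrivial R] : ∃ E : FGProj R, IsSimpleModule R E.carrier := by
  obtain ⟨m, hm⟩ := Ideal.exists_maximal R
  have := Module.projective_of_isSemisimpleRing R (R ⧸ m)
  exact ⟨⟨R ⧸ m⟩, isSimpleModule_iff_isCoatom.2 hm.out⟩

variable {R}

theorem ProjClass.exists_mk_eq_simple_add {P : FGProj R} [Nontrivial P.carrier] :
    ∃ S Q : FGProj R, IsSimpleModule R S.carrier ∧
      Module.length R Q.carrier < Module.length R P.carrier ∧
      ProjClass.mk P = ProjClass.mk S + ProjClass.mk Q := by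
  obtain ⟨S, hS⟩ := IsSemisimpleModule.exists_simple_submodule R P.carrier
  obtain ⟨Q, hSQ⟩ := exists_isCompl S
  have := Module.projective_of_isSemisimpleRing R S
  have := Module.projective_of_isSemisimpleRing R Q
  have hQ : Q ≠ ⊤ := fun h => (isSimpleModule_iff_isAtom.1 hS).1 (hSQ.disjoint.eq_bot_of_le
    (h ▸ le_top))
  exact ⟨⟨S⟩, ⟨Q⟩, hS, Submodule.length_lt hQ,
    (ProjClass.mk_eq_mk (E := FGProj.sum ⟨S⟩ ⟨Q⟩)).2 ⟨Submodule.prodEquivOfIsCompl S Q hSQ⟩ |>.symm⟩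

theorem ProjClass.closure_mk_simple :
    AddSubmonoid.closure (ProjClass.mk '' {S : FGProj R | IsSimpleModule R S.carrier}) = ⊤ := by
  refine closure_eq_top_of_exists_add (cls := ProjClass.mk) Quotient.mk_surjective
    (fun P => Module.length R P.carrier) fun P => ?_
  rcases subsingleton_or_nontrivial P.carrier with _ | _
  · exact .inl mk_eq_zero_of_subsingleton
  · obtain ⟨S, Q, hS, hlt, h⟩ := exists_mk_eq_simple_add (P := P)
    exact .inr ⟨_, ⟨S, hS, rfl⟩, Q, hlt, h⟩

end SemisimpleRing

section Multiplicity

variable {G : Type u} [Group G] [Finite G] {A : Type v} [Ring A] [Algebra ℂ A]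
  [MulSemiringAction G A] [SMulCommClass G ℂ A] [Module.Finite ℂ A]

instance fgProj_finite_complex (P : FGProj (SkewMonoidAlgebra A G)) : Module.Finite ℂ P.carrier :=
  .trans (SkewMonoidAlgebra A G) P.carrier

instance fgProj_finite_hom (S P : FGProj (SkewMonoidAlgebra A G)) :
    Module.Finite ℂ (S.carrier →ₗ[SkewMonoidAlgebra A G] P.carrier) :=
  .of_injective (LinearMap.restrictScalarsₗ ℂ (SkewMonoidAlgebra A G) S.carrier P.carrier ℂ)
    (LinearMap.restrictScalars_injective _)

/-- The dimension of the space of homomorphisms from `S`. For simple `S` it is the multiplicity of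
`S`, by Schur's lemma. -/
def homMult (S : FGProj (SkewMonoidAlgebra A G)) : ProjClass (SkewMonoidAlgebra A G) →+ ℕ where
  toFun := Quotient.lift
    (fun P => Module.finrank ℂ (S.carrier →ₗ[SkewMonoidAlgebra A G] P.carrier)) fun P Q ⟨e⟩ =>
      ((LinearEquiv.arrowCongrAddEquiv (.refl _ S.carrier) e).toLinearEquiv fun c f =>
        LinearMap.ext fun x => (e.toLinearMap.restrictScalars ℂ).map_smul c (f x)).finrank_eq
  map_zero' :=
    have : Subsingleton (FGProj.zero (R := SkewMonoidAlgebra A G)).carrier :=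
      inferInstanceAs (Subsingleton PUnit)
    Module.finrank_zero_of_subsingleton (R := ℂ)
      (M := S.carrier →ₗ[SkewMonoidAlgebra A G] (FGProj.zero (R := SkewMonoidAlgebra A G)).carrier)
  map_add' a b := by
    induction a using Quotient.inductionOn with | _ P
    induction b using Quotient.inductionOn with | _ Q
    exact (LinearMap.prodEquiv ℂ).finrank_eq.symm.trans Module.finrank_prod

theorem homMult_mk_self (S : FGProj (SkewMonoidAlgebra A G))
    [IsSimpleModule (SkewMonoidAlgebra A G) S.carrier] : homMult S (ProjClass.mk S) = 1 := by
  change Module.finrank ℂ (Module.End (SkewMonoidAlgebra A G) S.carrier) = 1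
  rw [← (LinearEquiv.ofBijective
    (Algebra.linearMap ℂ (Module.End (SkewMonoidAlgebra A G) S.carrier))
    (IsSimpleModule.algebraMap_end_bijective_of_isAlgClosed ℂ)).finrank_eq, Module.finrank_self]

theorem homMult_mk_of_ne {S T : FGProj (SkewMonoidAlgebra A G)}
    [IsSimpleModule (SkewMonoidAlgebra A G) S.carrier]
    [IsSimpleModule (SkewMonoidAlgebra A G) T.carrier] (h : ProjClass.mk S ≠ ProjClass.mk T) :
    homMult S (ProjClass.mk T) = 0 := by
  have : Subsingleton (S.carrier →ₗ[SkewMonoidAlgebra A G] T.carrier) :=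
    subsingleton_of_forall_eq 0 fun f => f.bijective_or_eq_zero.resolve_left fun hf =>
      h (ProjClass.mk_eq_mk.2 ⟨.ofBijective f hf⟩)
  exact Module.finrank_zero_of_subsingleton (R := ℂ)
    (M := S.carrier →ₗ[SkewMonoidAlgebra A G] T.carrier)

end Multiplicity

section Restriction

variable {G : Type u} [Group G]

theorem RepRing.res_charClass (H : Subgroup G) (χ : G →* ℂˣ) :
    RepRing.res H (GrothendieckAddGroup.of (charClass χ)) =
      GrothendieckAddGroup.of (charClass (χ.domRestrict H)) :=
  groth_lift_of _ _

theorem tmul_smul_repRing_tmul {H : Subgroup G} (r : RepRing G) (p : ℚ) (x : RepRing H) (q : ℚ) :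
    (r ⊗ₜ[ℤ] p : RepRing G ⊗[ℤ] ℚ) • (x ⊗ₜ[ℤ] q : RepRing H ⊗[ℤ] ℚ) =
      (RepRing.res H r * x) ⊗ₜ[ℤ] (p * q) := by
  change Algebra.TensorProduct.map (RepRing.res H).toIntAlgHom (AlgHom.id ℤ ℚ) (r ⊗ₜ[ℤ] p) *
    x ⊗ₜ[ℤ] q = _
  rw [Algebra.TensorProduct.map_tmul, Algebra.TensorProduct.tmul_mul_tmul]
  rfl

variable [Finite G] {A : Type v} [Ring A] [Algebra ℂ A] [MulSemiringAction G A]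
  [SMulCommClass G ℂ A] [Module.Finite ℂ A] [IsSemisimpleRing A]

theorem tmul_smul_K0_tmul (r : RepRing G) (p : ℚ) (x : K0 (SkewMonoidAlgebra A G)) (q : ℚ) :
    (r ⊗ₜ[ℤ] p : RepRing G ⊗[ℤ] ℚ) • (x ⊗ₜ[ℤ] q : K0 (SkewMonoidAlgebra A G) ⊗[ℤ] ℚ) =
      (r • x) ⊗ₜ[ℤ] (p * q) := by
  change Module.endTensorEndAlgHom (R := ℤ) (S := ℤ) (A := ℤ)
    (Algebra.TensorProduct.map (Algebra.lsmul ℤ ℤ (K0 (SkewMonoidAlgebra A G)))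
      (Algebra.lsmul ℤ ℤ ℚ) (r ⊗ₜ[ℤ] p)) (x ⊗ₜ[ℤ] q) = _
  rw [Algebra.TensorProduct.map_tmul, Module.endTensorEndAlgHom_apply,
    TensorProduct.AlgebraTensorModule.map_tmul]
  rfl

theorem nonempty_rat_equiv_of_equiv {H : Subgroup G}
    (T : K0 (SkewMonoidAlgebra A G) ≃ₗ[ℤ] RepRing H)
    (hT : ∀ (r : RepRing G) x, T (r • x) = RepRing.res H r * T x) :
    Nonempty (K0 (SkewMonoidAlgebra A G) ⊗[ℤ] ℚ ≃ₗ[RepRing G ⊗[ℤ] ℚ] RepRing H ⊗[ℤ] ℚ) := by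
  let e : K0 (SkewMonoidAlgebra A G) ⊗[ℤ] ℚ ≃ₗ[ℤ] RepRing H ⊗[ℤ] ℚ :=
    TensorProduct.congr T (.refl ℤ ℚ)
  have he : ∀ x q, e (x ⊗ₜ[ℤ] q) = T x ⊗ₜ[ℤ] q := fun _ _ => rfl
  refine ⟨e.toAddEquiv.toLinearEquiv fun r x => ?_⟩
  change e (r • x) = r • e x
  induction r using TensorProduct.induction_on with
  | zero =>
    exact (congrArg e (zero_smul (RepRing G ⊗[ℤ] ℚ) x)).trans
      ((map_zero e).trans (zero_smul (RepRing G ⊗[ℤ] ℚ) (e x)).symm)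
  | add r s hr hs => rw [add_smul, add_smul, map_add, hr, hs]
  | tmul r p =>
    induction x using TensorProduct.induction_on with
    | zero => rw [smul_zero, map_zero, smul_zero]
    | add x y hx hy => rw [smul_add, map_add, map_add, smul_add, hx, hy]
    | tmul x q => rw [tmul_smul_K0_tmul, he, he, tmul_smul_repRing_tmul, hT]

end Restriction

section KZeroCrossed

variable {G : Type u} [CommGroup G] [Finite G] {n : ℕ}
  [MulSemiringAction G (Matrix (Fin n) (Fin n) ℂ)]
  [SMulCommClass G ℂ (Matrix (Fin n) (Fin n) ℂ)]

theorem exists_domRestrict_eq (H : Subgroup G) (ψ : H →* ℂˣ) : ∃ χ : G →* ℂˣ, χ.domRestrict H = ψ :=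
  MonoidHom.domRestrict_surjective ℂ H ψ

/-- The twist of `E` by a character of `G` extending the character `ψ` of the image of the center.
The isomorphism class of the twist of a simple module does not depend on the chosen extension. -/
def centerTwist (E : FGProj (CrossedProduct G n)) (ψ : centerImage G n →* ℂˣ) :
    FGProj (CrossedProduct G n) :=
  twist (charRep (exists_domRestrict_eq _ ψ).choose) E

variable (E : FGProj (CrossedProduct G n))

instance centerTwist_isSimpleModule [IsSimpleModule (CrossedProduct G n) E.carrier]
    (ψ : centerImage G n →* ℂˣ) : IsSimpleModule (CrossedProduct G n) (centerTwist E ψ).carrier :=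
  isSimpleModule_twist _ E

variable [NeZero n] [IsSimpleModule (CrossedProduct G n) E.carrier]

theorem charClass_smul_eq_charClass_smul_iff {χ φ : G →* ℂˣ} :
    charClass χ • ProjClass.mk E = charClass φ • ProjClass.mk E ↔
      χ.domRestrict (centerImage G n) = φ.domRestrict (centerImage G n) := by
  have h_inv : charClass φ⁻¹ * charClass φ = 1 := by
    rw [← charClass_mul]
    exact (congrArg charClass (inv_mul_cancel φ)).trans charClass_one
  have h_inv' : charClass φ * charClass φ⁻¹ = 1 := by rw [mul_comm, h_inv]
  calc charClass χ • ProjClass.mk E = charClass φ • ProjClass.mk E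
    _ ↔ charClass (φ⁻¹ * χ) • ProjClass.mk E = ProjClass.mk E := by
      rw [charClass_mul, mul_smul]
      refine ⟨fun h => by rw [h, smul_smul, h_inv, one_smul], fun h => ?_⟩
      conv_rhs => rw [← h]
      rw [smul_smul, h_inv', one_smul]
    _ ↔ ∀ g ∈ centerImage G n, (φ⁻¹ * χ) g = 1 := charClass_smul_eq_self_iff E
    _ ↔ χ.domRestrict (centerImage G n) = φ.domRestrict (centerImage G n) := by
      simp only [MonoidHom.ext_iff, Subtype.forall, MonoidHom.domRestrict_apply]
      exact forall₂_congr fun g _ => inv_mul_eq_one.trans eq_comm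

theorem mk_centerTwist_domRestrict (χ : G →* ℂˣ) :
    ProjClass.mk (centerTwist E (χ.domRestrict (centerImage G n))) =
      charClass χ • ProjClass.mk E :=
  (charClass_smul_eq_charClass_smul_iff E).2 (exists_domRestrict_eq _ _).choose_spec

theorem mk_centerTwist_injective :
    Function.Injective fun ψ => ProjClass.mk (centerTwist E ψ) := by
  intro ψ φ h
  obtain ⟨ψ, rfl⟩ := exists_domRestrict_eq _ ψ
  obtain ⟨φ, rfl⟩ := exists_domRestrict_eq _ φ
  simp only [mk_centerTwist_domRestrict] at h
  exact (charClass_smul_eq_charClass_smul_iff E).1 h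

theorem closure_range_mk_centerTwist :
    AddSubmonoid.closure (Set.range fun ψ => ProjClass.mk (centerTwist E ψ)) = ⊤ := by
  have := crossed_isSemisimpleRing (G := G) (A := Matrix (Fin n) (Fin n) ℂ)
  rw [eq_top_iff, ← ProjClass.closure_mk_simple]
  refine AddSubmonoid.closure_mono ?_
  rintro _ ⟨F, hF : IsSimpleModule _ _, rfl⟩
  obtain ⟨χ, hχ⟩ := exists_charClass_smul_eq E F
  exact ⟨_, (mk_centerTwist_domRestrict E χ).trans hχ⟩

/-- The basis of `K₀` of the crossed product, indexed by the characters of the image of the center,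
which consists of the twists of the simple module `E`. -/
def k0Basis : Module.Basis (centerImage G n →* ℂˣ) ℤ (K0 (CrossedProduct G n)) :=
  grothBasis (m := fun ψ => homMult (centerTwist E ψ)) (fun _ => homMult_mk_self _)
    (fun _ _ h => homMult_mk_of_ne <| (mk_centerTwist_injective E).ne h)
    (closure_range_mk_centerTwist E)

theorem k0Basis_domRestrict (χ : G →* ℂˣ) :
    k0Basis E (χ.domRestrict (centerImage G n)) =
      GrothendieckAddGroup.of (charClass χ • ProjClass.mk E) :=
  (grothBasis_apply _ _ _ _).trans (congrArg _ (mk_centerTwist_domRestrict E χ))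

theorem charClass_smul_k0Basis (χ : G →* ℂˣ) (ψ : centerImage G n →* ℂˣ) :
    (GrothendieckAddGroup.of (charClass χ) : RepRing G) • k0Basis E ψ =
      k0Basis E (χ.domRestrict (centerImage G n) * ψ) := by
  obtain ⟨φ, rfl⟩ := exists_domRestrict_eq _ ψ
  have h_mul : χ.domRestrict (centerImage G n) * φ.domRestrict (centerImage G n) =
      (χ * φ).domRestrict (centerImage G n) := rfl
  rw [h_mul, k0Basis_domRestrict, k0Basis_domRestrict, charClass_mul, mul_smul]
  exact grothAct_of_of (S := RepClass G) (M := ProjClass (CrossedProduct G n)) _ _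

/-- The isomorphism from `K₀` of the crossed product to the representation ring of the image of the
center which matches the twists of the simple module `E` with the characters. -/
def k0EquivRepRing : K0 (CrossedProduct G n) ≃ₗ[ℤ] RepRing (centerImage G n) :=
  (k0Basis E).equiv (repRingBasis (centerImage G n)) (.refl _)

theorem k0EquivRepRing_charClass_smul (χ : G →* ℂˣ) (x : K0 (CrossedProduct G n)) :
    k0EquivRepRing E ((GrothendieckAddGroup.of (charClass χ) : RepRing G) • x) =
      RepRing.res (centerImage G n) (GrothendieckAddGroup.of (charClass χ)) *
        k0EquivRepRing E x := by
  have h_basis : ∀ ψ, k0EquivRepRing E (k0Basis E ψ) = GrothendieckAddGroup.of (charClass ψ) :=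
    fun ψ => by rw [k0EquivRepRing, Module.Basis.equiv_apply, Equiv.refl_apply, repRingBasis_apply]
  induction (k0Basis E).mem_span x using Submodule.span_induction with
  | zero => rw [smul_zero, map_zero, mul_zero]
  | add x y _ _ hx hy => rw [smul_add, map_add, map_add, mul_add, hx, hy]
  | smul c x _ hx => rw [smul_comm, map_zsmul, map_zsmul, hx, mul_smul_comm]
  | mem x hx =>
    obtain ⟨ψ, rfl⟩ := hx
    rw [charClass_smul_k0Basis, h_basis, h_basis, charClass_mul, RepRing.res_charClass]
    exact (grothAct_of_of (S := RepClass (centerImage G n))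
      (M := RepClass (centerImage G n)) _ _).symm

theorem k0EquivRepRing_smul (r : RepRing G) (x : K0 (CrossedProduct G n)) :
    k0EquivRepRing E (r • x) = RepRing.res (centerImage G n) r * k0EquivRepRing E x := by
  induction (repRingBasis G).mem_span r using Submodule.span_induction with
  | zero => rw [zero_smul, map_zero, map_zero, zero_mul]
  | add r s _ _ hr hs => rw [add_smul, map_add, map_add, add_mul, hr, hs]
  | smul c r _ hr => rw [smul_assoc, map_zsmul, map_zsmul, hr, smul_mul_assoc]
  | mem r hr =>
    obtain ⟨χ, rfl⟩ := hr
    rw [repRingBasis_apply, k0EquivRepRing_charClass_smul]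

end KZeroCrossed

end TwistedK

end

theorem theorem6p14 {G : Type*} [CommGroup G] [Finite G] {n : ℕ} (hn : 0 < n)
    [MulSemiringAction G (Matrix (Fin n) (Fin n) ℂ)]
    [SMulCommClass G ℂ (Matrix (Fin n) (Fin n) ℂ)] :
    Subsingleton (TwistedK.K1 (TwistedK.CrossedProduct G n)) ∧
    Module.Free ℤ (TwistedK.K0 (TwistedK.CrossedProduct G n)) ∧
    Module.Finite ℤ (TwistedK.K0 (TwistedK.CrossedProduct G n)) ∧
    Nonempty (TwistedK.RepRing G ⊗[ℤ] ℚ ≃+* MonoidAlgebra ℚ G) ∧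
    Nonempty (TwistedK.K0 (TwistedK.CrossedProduct G n) ⊗[ℤ] ℚ
      ≃ₗ[TwistedK.RepRing G ⊗[ℤ] ℚ]
        TwistedK.RepRing (TwistedK.centerImage G n) ⊗[ℤ] ℚ) ∧
    Module.finrank ℤ (TwistedK.K0 (TwistedK.CrossedProduct G n)) ∣ Nat.card G := by
  have := NeZero.of_pos hn
  have := TwistedK.crossed_isSemisimpleRing (G := G) (A := Matrix (Fin n) (Fin n) ℂ)
  obtain ⟨E, _⟩ := TwistedK.exists_simple_fgProj (TwistedK.CrossedProduct G n)
  let β := TwistedK.k0Basis E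
  refine ⟨TwistedK.subsingleton_K1 _, .of_basis β, .of_basis β,
    TwistedK.nonempty_repRing_rat_equiv G,
    TwistedK.nonempty_rat_equiv_of_equiv _ (TwistedK.k0EquivRepRing_smul E), ?_⟩
  rw [Module.finrank_eq_nat_card_basis β,
    CommGroup.card_monoidHom_of_hasEnoughRootsOfUnity (TwistedK.centerImage G n) ℂ]
  exact Subgroup.card_subgroup_dvd_card _
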